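/- **Setting.** Consider a two-player recursive stochastic game with a finite state space $S$, finite non-empty move sets $A_1^s, A_2^s$ at each state $s$, and transition probabilities $p(t\mid s;a,b)$. A state is absorbing if play never leaves it; $\mathcal A$ is the set of absorbing states. A play that reaches $a\in\mathcal A$ pays $r^k(a)$ to Player $k$, and a play that is never absorbed pays $0$ to both. Assume $r^1(a)\in[-\frac12,\frac12]$ and $r^2(a)\in[\omega,1]$ for all $a\in\mathcal A$, where $0<\omega<1$. The two players choose their moves simultaneously and observe the whole history; $\mathcal V^s_k(\sigma_1,\sigma_2)$ is Player $k$'s expected payoff from the start $s$. A pair $(\sigma_1,\sigma_2)$ is an $\eta$-equilibrium if, from every initial state, no player can gain more than $\eta$ by changing strategy. Let $c_k(s)$ be the (min-max) value for Player $k$ of the undiscounted zero-sum game from $s$ in which the opponent minimizes Player $k$'s payoff. For a mixed move $z$ of Player $k$'s opponent at $s$, let $j^k_z(s)=\max_c\sum_t p(t\mid s;c,z)\,c_k(t)$, the maximum being over the moves $c$ of Player $k$ at $s$. For stationary strategies $(x,y)$, let $r^k_{x,y}(s)$ be Player $k$'s expected payoff from $s$, and for a move $c$ of Player $k$ at $s$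 let $w^k_{x,y}(c)$ be the expected value of $r^k_{x,y}$ at the next state when $c$ is played at $s$ against the opponent's stationary strategy. The pair is absorbing if $\mathcal A$ is reached with probability one from every start. **Testing and punishment.** For $\varepsilon>0$, we say that $(x,y)$ *generates* an $\eta$-equilibrium if there are deadlines $n_{s_0}\in\mathbb N$ $(s_0\in S)$ and strategies $\tau_1,\tau_2$ such that * under $(x,y)$ from $s_0$, the probability of no absorption before stage $n_{s_0}$ is less than $\varepsilon/10$; * $\tau_1$ holds Player Two to at most $c_2(s)+\varepsilon$, and $\tau_2$ holds Player One to at most $c_1(s)+\varepsilon$, from every state $s$; * the following pair of strategies is an $\eta$-equilibrium. From the start $s_0$ the players follow $(x,y)$ as long as at every past stage $l$ the test was passed, which means: $l\le n_{s_0}$, both players used only moves that have positive probability under $(x,y)$, and $\sum_{i=0}^{l}\bigl(w^k_{x,y}(c^k_i)-r^k_{x,y}(s_i)\bigr)\le\varepsilon$ for both $k$, where $s_i$ is the state and $c^k_i$ the move of Player $k$ at stage $i$. If the test first fails at stage $l$, then from stage $l+1$ on both players play $(\tau_1,\tau_2)$, as if the game started at $s_{l+1}$. **(Corollary 4.3)**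 Let $(x,y)$ be an absorbing pair of stationary strategies, let $0<\varepsilon<\frac12$ and $\delta\le\varepsilon^3/|S|$. Assume that 1. $r^1_{x,y}(s)>j^1_y(s)-\varepsilon$ and $r^2_{x,y}(s)>j^2_x(s)-\varepsilon$ for every $s\in S$; 2. $|w^k_{x,y}(c)-r^k_{x,y}(s)|\le\delta$ for both players $k$, every $s\in S$ and every move $c$ that Player $k$ uses at $s$ with positive probability. Then $(x,y)$ generates a $4\varepsilon$-equilibrium of the game. **(Corollary 4.4)** For every $s\in S$ let $\mathcal P^s$ be a partition of the set of finite histories (of positive-probability transitions, the length-zero history included) that end at $s$. The cells of all these partitions are called situations; let $\hat S$ be the set of situations, let $b(c)$ be the state at which the histories in $c\in\hat S$ end, and assume that $\hat S$ is finite. Assume that the situations are normal: the present situation, the moves of both players and the next state determine the next situation. Let $x$ and $y$ assign to every situation $c$ a mixed move of Player One, respectively Player Two, at $b(c)$. They define a Markov chain on $\hat S$; assume that from every situation it reaches with probability one a situation over an absorbing state. Let $\hat r^k_{x,y}(c)$ be Player $k$'s expected payoff in this chain started at $c$, and $\hat w^k_{x,y}$ the corresponding expected value of $\hat r^k_{x,y}$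 at the next stage. Let $\varepsilon>0$ and $\delta\le\varepsilon^3/|\hat S|$. Assume that 1. $\hat r^1_{x,y}(c)\ge j^1_{y}(b(c))-\varepsilon$ and $\hat r^2_{x,y}(c)\ge j^2_{x}(b(c))-\varepsilon$ for every $c\in\hat S$, where $x,y$ stand for the mixed moves used in the situation $c$; 2. $|\hat w^k_{x,y}(d)-\hat r^k_{x,y}(c)|\le\delta$ for both players $k$, every $c\in\hat S$ and every move $d$ that Player $k$ uses in the situation $c$ with positive probability. Then $(x,y)$, played as strategies of the original game and with the above testing and punishment (with $\hat w,\hat r$ and situations in place of $w,r$ and states), generates a $4\varepsilon$-equilibrium of the original game. -/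

import Mathlib

open MeasureTheory ProbabilityTheory

/-- A two-player stochastic game with state space `S` in which Player One chooses moves from `A s`
and Player Two from `B s` at the state `s`, with transition probabilities `trans s a b` and with
evaluations `r₁`, `r₂` of the two players. The evaluations are only ever read at absorbing states:
the game is recursive. -/
structure RecursiveGame {S : Type*} (A B : S → Type*) where
  /-- `trans s a b t` is the probability `p(t | s; a, b)`. -/
  trans : ∀ s, A s → B s → PMF S
  /-- Player One's evaluation of the absorbing states. -/
  r₁ : S → ℝ
  /-- Player Two's evaluation of the absorbing states. -/
  r₂ : S → ℝ

/-- The transition kernel of the time homogeneous Markov chain with transitions `K`, as a kernel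
that depends only on the last state of a finite path. -/
noncomputable def chainKernel {α : Type*} [MeasurableSpace α] [DiscreteMeasurableSpace α]
    (K : α → PMF α) (n : ℕ) : Kernel ((_ : Finset.Iic n) → α) α where
  toFun path := (K (path ⟨n, Finset.mem_Iic.2 le_rfl⟩)).toMeasure
  measurable' := (Measurable.of_discrete (f := fun a => (K a).toMeasure)).comp
    (measurable_pi_apply _)

instance {α : Type*} [MeasurableSpace α] [DiscreteMeasurableSpace α] (K : α → PMF α) (n : ℕ) :
    IsMarkovKernel (chainKernel K n) :=
  ⟨fun _ => PMF.toMeasure.isProbabilityMeasure _⟩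

/-- The law, on infinite paths, of the time homogeneous Markov chain with transitions `K` that
starts at `a₀`. -/
noncomputable def chainLaw {α : Type*} [MeasurableSpace α] [DiscreteMeasurableSpace α]
    (K : α → PMF α) (a₀ : α) : Measure (ℕ → α) :=
  Kernel.trajMeasure (X := fun _ => α) (Measure.dirac a₀) (chainKernel K)

namespace RecursiveGame

section Game

universe u v w

variable {S : Type u} {A : S → Type v} {B : S → Type w} (G : RecursiveGame A B)

/-- An absorbing state: play never leaves it. -/
def IsAbsorbing (s : S) : Prop := ∀ a b, G.trans s a b = PMF.pure s

open Classical in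
/-- The evaluation of an infinite sequence of states: the value of `r` at the absorbing state that
is reached, and zero if no absorbing state is ever reached. -/
noncomputable def evaluate (r : S → ℝ) (path : ℕ → S) : ℝ :=
  if h : ∃ n, G.IsAbsorbing (path n) then r (path (Nat.find h)) else 0

/-- `G.Hist s` is the set of finite histories
`(s₀, a₀, b₀), …, (sᵢ₋₁, aᵢ₋₁, bᵢ₋₁), sᵢ = s` that end at the state `s` and all of whose
transitions have positive probability. -/
inductive Hist : S → Type (max u v w)
  | start (s : S) : Hist s
  | snoc {s t : S} (h : Hist s) (a : A s) (b : B s) (ht : t ∈ (G.trans s a b).support) : Hist t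

variable {G} in
/-- The number `i` of completed stages of a history, which is the index of the current stage. -/
def Hist.stage : ∀ {s : S}, G.Hist s → ℕ
  | _, .start _ => 0
  | _, .snoc h _ _ _ => h.stage + 1

variable {G} in
/-- The state in which a history began. -/
def Hist.root : ∀ {s : S}, G.Hist s → S
  | _, .start s => s
  | _, .snoc h _ _ _ => h.root

/-- All finite histories. -/
structure AnyHist : Type (max u v w) where
  /-- The present state. -/
  state : S
  /-- The history that ends at the present state. -/
  hist : G.Hist state

instance : MeasurableSpace G.AnyHist := ⊤

instance : DiscreteMeasurableSpace G.AnyHist := ⟨fun _ => trivial⟩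

/-- A (behavior) strategy of Player One. -/
abbrev Strategy₁ : Type _ := ∀ ⦃s : S⦄, G.Hist s → PMF (A s)

/-- A (behavior) strategy of Player Two. -/
abbrev Strategy₂ : Type _ := ∀ ⦃s : S⦄, G.Hist s → PMF (B s)

/-- One stage of play: the two players choose their moves independently, as their strategies tell
them after the history `h`, and the next state is drawn. -/
noncomputable def playStep (σ₁ : G.Strategy₁) (σ₂ : G.Strategy₂) (h : G.AnyHist) : PMF G.AnyHist :=
  (σ₁ h.hist).bind fun a => (σ₂ h.hist).bind fun b =>
    (G.trans h.state a b).bindOnSupport fun t ht => PMF.pure ⟨t, h.hist.snoc a b ht⟩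

/-- The distribution on infinite plays that starts at `s` and is induced by a pair of strategies.
An infinite play is given by the sequence of its finite truncations. -/
noncomputable def playLaw (σ₁ : G.Strategy₁) (σ₂ : G.Strategy₂) (s : S) :
    Measure (ℕ → G.AnyHist) :=
  chainLaw (G.playStep σ₁ σ₂) ⟨s, .start s⟩

/-- Player One's expected payoff `𝒱₁ˢ(σ₁, σ₂)`. -/
noncomputable def V₁ (s : S) (σ₁ : G.Strategy₁) (σ₂ : G.Strategy₂) : ℝ :=
  ∫ ω, G.evaluate G.r₁ (fun n => (ω n).state) ∂(G.playLaw σ₁ σ₂ s)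

/-- Player Two's expected payoff `𝒱₂ˢ(σ₁, σ₂)`. -/
noncomputable def V₂ (s : S) (σ₁ : G.Strategy₁) (σ₂ : G.Strategy₂) : ℝ :=
  ∫ ω, G.evaluate G.r₂ (fun n => (ω n).state) ∂(G.playLaw σ₁ σ₂ s)

/-- `(σ₁, σ₂)` is an `η`-equilibrium. -/
def IsEquilibrium (η : ℝ) (σ₁ : G.Strategy₁) (σ₂ : G.Strategy₂) : Prop :=
  ∀ s, (∀ σ₁' : G.Strategy₁, G.V₁ s σ₁' σ₂ ≤ G.V₁ s σ₁ σ₂ + η) ∧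
    (∀ σ₂' : G.Strategy₂, G.V₂ s σ₁ σ₂' ≤ G.V₂ s σ₁ σ₂ + η)

/-- The value `c₁(s)` for Player One of the undiscounted zero-sum game, started at `s`, in which
Player Two minimizes Player One's payoff. -/
noncomputable def c₁ (s : S) : ℝ := ⨅ σ₂ : G.Strategy₂, ⨆ σ₁ : G.Strategy₁, G.V₁ s σ₁ σ₂

/-- The value `c₂(s)` for Player Two of the undiscounted zero-sum game, started at `s`, in which
Player One minimizes Player Two's payoff. -/
noncomputable def c₂ (s : S) : ℝ := ⨅ σ₁ : G.Strategy₁, ⨆ σ₂ : G.Strategy₂, G.V₂ s σ₁ σ₂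

variable [Fintype S] [∀ s, Fintype (A s)] [∀ s, Fintype (B s)]

/-- The expectation of `f` at the next state if the moves `a`, `b` are played at `s`. -/
noncomputable def next (f : S → ℝ) (s : S) (a : A s) (b : B s) : ℝ :=
  ∑ t, (G.trans s a b t).toReal * f t

/-- The jump function `j¹(s)` against the mixed move `y` of Player Two at `s`. -/
noncomputable def jump₁ (s : S) (y : PMF (B s)) : ℝ :=
  ⨆ a : A s, ∑ b, (y b).toReal * G.next G.c₁ s a b

/-- The jump function `j²(s)` against the mixed move `x` of Player One at `s`. -/
noncomputable def jump₂ (s : S) (x : PMF (A s)) : ℝ :=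
  ⨆ b : B s, ∑ a, (x a).toReal * G.next G.c₂ s a b

end Game

section TestAndPunish

/-! ### Statistical testing and mutual punishment

`β₁`, `β₂` are the strategies that the players are supposed to follow, and `g₁ h a`, `g₂ h b` are
the changes in the expected payoff of Player One, respectively Player Two, that are caused by the
use of the move `a`, respectively `b`, after the history `h`. -/

universe u v w

variable {S : Type u} {A : S → Type v} {B : S → Type w} (G : RecursiveGame A B)
  (β₁ : G.Strategy₁) (β₂ : G.Strategy₂)
  (g₁ : ∀ ⦃s : S⦄, G.Hist s → A s → ℝ) (g₂ : ∀ ⦃s : S⦄, G.Hist s → B s → ℝ)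

/-- The sum of the changes in Player One's expected payoff caused by her moves in a history. -/
def score₁ : ∀ {s : S}, G.Hist s → ℝ
  | _, .start _ => 0
  | _, .snoc h a _ _ => score₁ h + g₁ h a

/-- The sum of the changes in Player Two's expected payoff caused by his moves in a history. -/
def score₂ : ∀ {s : S}, G.Hist s → ℝ
  | _, .start _ => 0
  | _, .snoc h _ b _ => score₂ h + g₂ h b

/-- The test passed at the stage that follows the history `h`, when `a` and `b` are played there:
the stage does not exceed the deadline, which may depend on the initial state, both players use
moves that they should use with positive probability, and neither player's moves have so far
increased the player's expected payoff by more than `ε` in total. -/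
def Passes (ε : ℝ) (deadline : S → ℕ) {s : S} (h : G.Hist s) (a : A s) (b : B s) : Prop :=
  h.stage ≤ deadline h.root ∧ a ∈ (β₁ h).support ∧ b ∈ (β₂ h).support ∧
    G.score₁ g₁ h + g₁ h a ≤ ε ∧ G.score₂ g₂ h + g₂ h b ≤ ε

open Classical in
/-- `none` as long as all tests have been passed; once a test has failed at some stage, the part of
the history that begins with the following stage. -/
noncomputable def sinceFailure (ε : ℝ) (deadline : S → ℕ) :
    ∀ {s : S}, G.Hist s → Option (G.Hist s)
  | _, .start _ => none
  | _, .snoc (t := t) h a b ht =>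
    match sinceFailure ε deadline h with
    | some h' => some (h'.snoc a b ht)
    | none => if G.Passes β₁ β₂ g₁ g₂ ε deadline h a b then none else some (.start t)

/-- Player One follows `β₁` until a test has failed, and from the next stage on she plays the
punishing strategy `τ₁` as if the game began there. -/
noncomputable def testAndPunish₁ (ε : ℝ) (deadline : S → ℕ) (τ₁ : G.Strategy₁) : G.Strategy₁ :=
  fun _ h => match G.sinceFailure β₁ β₂ g₁ g₂ ε deadline h with
    | none => β₁ h
    | some h' => τ₁ h'

/-- Player Two follows `β₂` until a test has failed, and from the next stage on he plays the
punishing strategy `τ₂` as if the game began there. -/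
noncomputable def testAndPunish₂ (ε : ℝ) (deadline : S → ℕ) (τ₂ : G.Strategy₂) : G.Strategy₂ :=
  fun _ h => match G.sinceFailure β₁ β₂ g₁ g₂ ε deadline h with
    | none => β₂ h
    | some h' => τ₂ h'

/-- With statistical testing (tolerance `ε`) and mutual punishment, `(β₁, β₂)` generates an
`η`-equilibrium: for a deadline before which play according to `(β₁, β₂)` is absorbed up to a
probability less than `ε / 10`, and for strategies `τ₁`, `τ₂` that hold the opponent down to
`c₂ + ε` and `c₁ + ε`, testing and punishing is an `η`-equilibrium. -/
def GeneratesEquilibrium (ε η : ℝ) : Prop :=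
  ∃ (deadline : S → ℕ) (τ₁ : G.Strategy₁) (τ₂ : G.Strategy₂),
    (∀ s, G.playLaw β₁ β₂ s {ω | ∀ n < deadline s, ¬ G.IsAbsorbing (ω n).state}
      < ENNReal.ofReal (ε / 10)) ∧
    (∀ s (σ₂ : G.Strategy₂), G.V₂ s τ₁ σ₂ ≤ G.c₂ s + ε) ∧
    (∀ s (σ₁ : G.Strategy₁), G.V₁ s σ₁ τ₂ ≤ G.c₁ s + ε) ∧
    G.IsEquilibrium η (G.testAndPunish₁ β₁ β₂ g₁ g₂ ε deadline τ₁)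
      (G.testAndPunish₂ β₁ β₂ g₁ g₂ ε deadline τ₂)

end TestAndPunish

section Stationary

universe u v w

variable {S : Type u} {A : S → Type v} {B : S → Type w} (G : RecursiveGame A B)

/-- The strategy of Player One that plays `x s` whenever the state is `s`. -/
def stationary₁ (x : ∀ s, PMF (A s)) : G.Strategy₁ := fun s _ => x s

/-- The strategy of Player Two that plays `y s` whenever the state is `s`. -/
def stationary₂ (y : ∀ s, PMF (B s)) : G.Strategy₂ := fun s _ => y s

variable (x : ∀ s, PMF (A s)) (y : ∀ s, PMF (B s))

/-- From every start an absorbing state is reached with probability one. -/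
def AbsorbingPair : Prop :=
  ∀ s, ∀ᵐ ω ∂(G.playLaw (G.stationary₁ x) (G.stationary₂ y) s), ∃ n, G.IsAbsorbing (ω n).state

/-- `r¹_{x,y}(s)`. -/
noncomputable def value₁ (s : S) : ℝ := G.V₁ s (G.stationary₁ x) (G.stationary₂ y)

/-- `r²_{x,y}(s)`. -/
noncomputable def value₂ (s : S) : ℝ := G.V₂ s (G.stationary₁ x) (G.stationary₂ y)

variable [Fintype S] [∀ s, Fintype (A s)] [∀ s, Fintype (B s)]

/-- `w¹_{x,y}(a)` for a move `a` of Player One at `s`: the expectation of `r¹_{x,y}` at the next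
stage. -/
noncomputable def w₁ (s : S) (a : A s) : ℝ :=
  ∑ b, (y s b).toReal * G.next (G.value₁ x y) s a b

/-- `w²_{x,y}(b)` for a move `b` of Player Two at `s`: the expectation of `r²_{x,y}` at the next
stage. -/
noncomputable def w₂ (s : S) (b : B s) : ℝ :=
  ∑ a, (x s a).toReal * G.next (G.value₂ x y) s a b

end Stationary

section Situations

universe u v w

variable {S : Type u} {A : S → Type v} {B : S → Type w} (G : RecursiveGame A B)

/-- The situations: `P s` partitions the set of histories that end at `s`, and a situation is a
cell of one of these partitions. -/
structure Situation (P : ∀ s, Setoid (G.Hist s)) : Type (max u v w) where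
  /-- The state `b(c)` of the situation `c`. -/
  state : S
  /-- The cell of the partition `P (b(c))`. -/
  cell : Quotient (P state)

instance (P : ∀ s, Setoid (G.Hist s)) : MeasurableSpace (G.Situation P) := ⊤

instance (P : ∀ s, Setoid (G.Hist s)) : DiscreteMeasurableSpace (G.Situation P) :=
  ⟨fun _ => trivial⟩

/-- The situations are normal: the present situation, the moves of the players and the next state
determine the next situation. -/
def Normal (P : ∀ s, Setoid (G.Hist s)) : Prop :=
  ∀ ⦃s : S⦄ (h h' : G.Hist s), P s h h' →
    ∀ (a : A s) (b : B s) (t : S) (ht : t ∈ (G.trans s a b).support),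
      P t (h.snoc a b ht) (h'.snoc a b ht)

variable {P : ∀ s, Setoid (G.Hist s)}

/-- The situation in which play is after the history `h`. -/
def situation {s : S} (h : G.Hist s) : G.Situation P := ⟨s, Quotient.mk (P s) h⟩

variable {G} in
/-- The situation that follows `c` if `a` and `b` are played and the next state is `t`. -/
def Normal.next (hP : G.Normal P) (c : G.Situation P) (a : A c.state) (b : B c.state) {t : S}
    (ht : t ∈ (G.trans c.state a b).support) : G.Situation P :=
  ⟨t, Quotient.lift (s := P c.state) (fun h => Quotient.mk (P t) (h.snoc a b ht))
    (fun h h' hh => Quotient.sound (hP h h' hh a b t ht)) c.cell⟩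

/-- The strategy of Player One that plays `x c` whenever the situation is `c`. -/
def onSituations₁ (x : ∀ c : G.Situation P, PMF (A c.state)) : G.Strategy₁ :=
  fun _ h => x (G.situation h)

/-- The strategy of Player Two that plays `y c` whenever the situation is `c`. -/
def onSituations₂ (y : ∀ c : G.Situation P, PMF (B c.state)) : G.Strategy₂ :=
  fun _ h => y (G.situation h)

variable {G}

namespace Normal

variable (hP : G.Normal P)
  (x : ∀ c : G.Situation P, PMF (A c.state)) (y : ∀ c : G.Situation P, PMF (B c.state))

/-- The transitions between situations that are generated by `(x, y)`. -/
noncomputable def step (c : G.Situation P) : PMF (G.Situation P) :=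
  (x c).bind fun a => (y c).bind fun b =>
    (G.trans c.state a b).bindOnSupport fun _ ht => PMF.pure (hP.next c a b ht)

/-- From every situation an absorbing state is reached with probability one. -/
def AbsorbingPair : Prop :=
  ∀ c, ∀ᵐ ω ∂(chainLaw (hP.step x y) c), ∃ n, G.IsAbsorbing (ω n).state

/-- The expected payoff `r̂¹_{x,y}(c)` of Player One when play starts in the situation `c`. -/
noncomputable def value₁ (c : G.Situation P) : ℝ :=
  ∫ ω, G.evaluate G.r₁ (fun n => (ω n).state) ∂(chainLaw (hP.step x y) c)

/-- The expected payoff `r̂²_{x,y}(c)` of Player Two when play starts in the situation `c`. -/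
noncomputable def value₂ (c : G.Situation P) : ℝ :=
  ∫ ω, G.evaluate G.r₂ (fun n => (ω n).state) ∂(chainLaw (hP.step x y) c)

open Classical in
/-- The expectation of `f` at the next situation if `a` and `b` are played in the situation `c`. -/
noncomputable def expectNext [Fintype S] (f : G.Situation P → ℝ) (c : G.Situation P)
    (a : A c.state) (b : B c.state) : ℝ :=
  ∑ t, if ht : t ∈ (G.trans c.state a b).support then
    (G.trans c.state a b t).toReal * f (hP.next c a b ht) else 0

variable [Fintype S] [∀ s, Fintype (A s)] [∀ s, Fintype (B s)]

/-- `ŵ¹_{x,y}(a)` for a move `a` of Player One in the situation `c`. -/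
noncomputable def w₁ (c : G.Situation P) (a : A c.state) : ℝ :=
  ∑ b, (y c b).toReal * hP.expectNext (hP.value₁ x y) c a b

/-- `ŵ²_{x,y}(b)` for a move `b` of Player Two in the situation `c`. -/
noncomputable def w₂ (c : G.Situation P) (b : B c.state) : ℝ :=
  ∑ a, (x c a).toReal * hP.expectNext (hP.value₂ x y) c a b

end Normal

end Situations

end RecursiveGame

/-! Let `v` be a player's expected payoff under `(x, y)`, as a function of the situation, and let
her score be the sum of the changes of `v` caused by her own moves. Two estimates compare `v` with
the payoffs under testing and punishment; the errors of the first, about `2ε`, and of the second,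
less than `2ε`, add up to less than `4ε`.

Deviating gains little. Whatever move she chooses, the conditional mean of `v` minus the score does
not change, because the score increases by exactly the drift of `v`. As long as the test is passed
the score is at most `ε`. Once it fails, punishment pays at most `c + ε'`, and `c ≤ j ≤ v + ε`.
Backward induction from the deadline bounds her payoff by `v + 2ε + ε'` (`c₁_le_jump₁`,
`histValue_deviation₁_le` and their counterparts for Player Two).

Complying loses little. Under `(x, y)` the scores are martingales with increments at most `δ`, so
the mean square of a score is at most `δ` times the expected sum of the absolute increments. A
failed test means that some score exceeds `ε`, and Chebyshev's argument bounds the loss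
(`le_histValue_testAndPunish`). What remains is a bound on the expected sum of absolute increments
that does not depend on the horizon. By `expectedSum_le` it is at most the number `n` of situations
times the length of the payoff interval. With `δ ≤ ε³ / n` the two tests cost at most `ε` and `(1 -
ω)ε`, and the spare `ωε` pays for imperfect punishment and for plays that outlast the deadline.

Stationary strategies on states are the case in which all histories ending at the same state form
one situation. -/

set_option linter.unusedSectionVars false

/-! ### Expectations over finite sets -/

/-- The expectation under `p` of a function that is defined on the support of `p`. -/
noncomputable def PMF.mean {α : Type*} [Fintype α] (p : PMF α) (f : ∀ a, a ∈ p.support → ℝ) : ℝ :=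
  open Classical in ∑ a, if h : a ∈ p.support then (p a).toReal * f a h else 0

section Mean

variable {α β : Type*} [Fintype α] [Fintype β] (p : PMF α) (q : PMF β)

theorem PMF.mean_congr {f g : ∀ a, a ∈ p.support → ℝ} (h : ∀ a ha, f a ha = g a ha) :
    p.mean f = p.mean g := by
  congr 1; funext a ha; exact h a ha

theorem PMF.mean_mono {f g : ∀ a, a ∈ p.support → ℝ} (h : ∀ a ha, f a ha ≤ g a ha) :
    p.mean f ≤ p.mean g := by
  unfold PMF.mean
  refine Finset.sum_le_sum fun a _ => ?_
  split_ifs with ha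
  · exact mul_le_mul_of_nonneg_left (h a ha) ENNReal.toReal_nonneg
  · exact le_rfl

theorem PMF.mean_eq_sum (f : α → ℝ) : p.mean (fun a _ => f a) = ∑ a, (p a).toReal * f a := by
  unfold PMF.mean
  refine Finset.sum_congr rfl fun a _ => ?_
  split_ifs with ha
  · rfl
  · rw [PMF.mem_support_iff, not_not] at ha
    simp [ha]

theorem PMF.sum_toReal : ∑ a, (p a).toReal = 1 := by
  rw [← ENNReal.toReal_sum fun a _ => p.apply_ne_top a, ← tsum_fintype (L := .unconditional α),
    p.tsum_coe, ENNReal.toReal_one]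

theorem PMF.mean_const (c : ℝ) : p.mean (fun _ _ => c) = c := by
  rw [PMF.mean_eq_sum, ← Finset.sum_mul, p.sum_toReal, one_mul]

theorem PMF.mean_add (f g : ∀ a, a ∈ p.support → ℝ) :
    p.mean (fun a ha => f a ha + g a ha) = p.mean f + p.mean g := by
  unfold PMF.mean
  rw [← Finset.sum_add_distrib]
  refine Finset.sum_congr rfl fun a _ => ?_
  split_ifs <;> ring

theorem PMF.mean_const_mul (c : ℝ) (f : ∀ a, a ∈ p.support → ℝ) :
    p.mean (fun a ha => c * f a ha) = c * p.mean f := by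
  unfold PMF.mean
  rw [Finset.mul_sum]
  refine Finset.sum_congr rfl fun a _ => ?_
  split_ifs <;> ring

theorem PMF.mean_sub (f g : ∀ a, a ∈ p.support → ℝ) :
    p.mean (fun a ha => f a ha - g a ha) = p.mean f - p.mean g := by
  unfold PMF.mean
  rw [← Finset.sum_sub_distrib]
  refine Finset.sum_congr rfl fun a _ => ?_
  split_ifs <;> ring

theorem PMF.abs_mean_sub_le (f : ∀ a, a ∈ p.support → ℝ) (c : ℝ) :
    |p.mean f - c| ≤ p.mean fun a ha => |f a ha - c| := by
  have h : p.mean (fun a ha => f a ha - c) = p.mean f - c := by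
    rw [PMF.mean_sub, PMF.mean_const]
  rw [← h]
  refine abs_le.2 ⟨?_, p.mean_mono fun a ha => le_abs_self _⟩
  rw [neg_eq_neg_one_mul, ← PMF.mean_const_mul]
  refine p.mean_mono fun a ha => ?_
  linarith [neg_abs_le (f a ha - c)]

theorem PMF.mean_comm (f : ∀ a, a ∈ p.support → ∀ b, b ∈ q.support → ℝ) :
    (p.mean fun a ha => q.mean fun b hb => f a ha b hb)
      = q.mean fun b hb => p.mean fun a ha => f a ha b hb := by
  classical
  unfold PMF.mean
  have h₁ : ∀ a b, (if ha : a ∈ p.support then (p a).toReal *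
        (if hb : b ∈ q.support then (q b).toReal * f a ha b hb else 0) else 0) =
      if hb : b ∈ q.support then (q b).toReal *
        (if ha : a ∈ p.support then (p a).toReal * f a ha b hb else 0) else 0 := by
    intro a b
    split_ifs <;> ring
  calc _ = ∑ a, ∑ b, (if ha : a ∈ p.support then (p a).toReal *
        (if hb : b ∈ q.support then (q b).toReal * f a ha b hb else 0) else 0) := by
        refine Finset.sum_congr rfl fun a _ => ?_
        split_ifs
        · rw [Finset.mul_sum]
        · simp
    _ = _ := by
        rw [Finset.sum_comm]
        refine Finset.sum_congr rfl fun b _ => ?_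
        rw [Finset.sum_congr rfl fun a _ => h₁ a b]
        split_ifs
        · rw [Finset.mul_sum]
        · simp

end Mean

/-! ### The transition operator of a Markov chain -/

section Operator

/-- The transition operator of the Markov chain with transitions `K`. -/
noncomputable def chainOp {α : Type*} [MeasurableSpace α] (K : α → PMF α) (f : α → ℝ) (a : α) : ℝ :=
  ∫ b, f b ∂(K a).toMeasure

variable {α : Type*} [MeasurableSpace α]

theorem abs_chainOp_le (K : α → PMF α) {f : α → ℝ} {C : ℝ} (hf : ∀ a, |f a| ≤ C) (a : α) :
    |chainOp K f a| ≤ C := by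
  have h := norm_integral_le_of_norm_le_const (μ := (K a).toMeasure) (f := f) (C := C)
    (Filter.Eventually.of_forall hf)
  simpa [chainOp] using h

theorem abs_chainOp_iterate_le (K : α → PMF α) {f : α → ℝ} {C : ℝ} (hf : ∀ a, |f a| ≤ C) (n : ℕ) :
    ∀ a, |(chainOp K)^[n] f a| ≤ C := by
  induction n with
  | zero => exact hf
  | succ n ih => rw [Function.iterate_succ_apply']; exact abs_chainOp_le K ih

variable [DiscreteMeasurableSpace α]

theorem integrable_of_discrete (μ : Measure α) [IsFiniteMeasure μ] {f : α → ℝ} {C : ℝ}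
    (hf : ∀ a, |f a| ≤ C) : Integrable f μ :=
  Integrable.of_bound (Measurable.of_discrete (f := f)).aestronglyMeasurable C
    (Filter.Eventually.of_forall hf)

theorem tendsto_chainOp (K : α → PMF α) {f : ℕ → α → ℝ} {g : α → ℝ} {C : ℝ}
    (hf : ∀ n a, |f n a| ≤ C) (h : ∀ a, Filter.Tendsto (fun n => f n a) Filter.atTop (nhds (g a)))
    (a : α) : Filter.Tendsto (fun n => chainOp K (f n) a) Filter.atTop (nhds (chainOp K g a)) :=
  tendsto_integral_of_dominated_convergence (fun _ => C)
    (fun n => (Measurable.of_discrete (f := f n)).aestronglyMeasurable) (integrable_const C)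
    (fun n => Filter.Eventually.of_forall (hf n)) (Filter.Eventually.of_forall h)

theorem integral_bind_fintype {X : Type*} [Fintype X] (r : PMF X) (k : X → PMF α)
    {f : α → ℝ} {C : ℝ} (hf : ∀ a, |f a| ≤ C) :
    ∫ c, f c ∂(r.bind k).toMeasure = r.mean fun a _ => ∫ c, f c ∂(k a).toMeasure := by
  have hm : (r.bind k).toMeasure = ∑ a, r a • (k a).toMeasure := by
    ext s hs
    rw [PMF.toMeasure_bind_apply _ _ _ hs, tsum_fintype]
    simp
  rw [hm, integral_finsetSum_measure, PMF.mean_eq_sum]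
  · simp [integral_smul_measure]
  · intro a _
    exact (integrable_of_discrete _ hf).smul_measure (r.apply_ne_top a)

/-- The expectation over one stage: both players move independently and the next state is drawn. -/
theorem integral_stage {A B S : Type*} [Fintype A] [Fintype B] [Fintype S]
    (p : PMF A) (q : PMF B) (T : A → B → PMF S) (φ : ∀ a b t, t ∈ (T a b).support → α)
    {f : α → ℝ} {C : ℝ} (hf : ∀ a, |f a| ≤ C) :
    ∫ c, f c ∂(p.bind fun a => q.bind fun b =>
        (T a b).bindOnSupport fun t ht => PMF.pure (φ a b t ht)).toMeasure =
      p.mean fun a _ => q.mean fun b _ => (T a b).mean fun t ht => f (φ a b t ht) := by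
  have hsup : ∀ (r : PMF S) (k : ∀ t ∈ r.support, α),
      ∫ c, f c ∂(r.bindOnSupport fun t ht => PMF.pure (k t ht)).toMeasure =
        r.mean fun t ht => f (k t ht) := by
    intro r k
    classical
    have hm : (r.bindOnSupport fun t ht => PMF.pure (k t ht)).toMeasure =
        ∑ t, r t • (if h : t ∈ r.support then Measure.dirac (k t h) else 0) := by
      ext s hs
      rw [PMF.toMeasure_bindOnSupport_apply (hs := hs), tsum_fintype]
      simp only [Measure.coe_finsetSum, Finset.sum_apply, Measure.smul_apply, smul_eq_mul]
      refine Finset.sum_congr rfl fun t _ => ?_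
      by_cases h : r t = 0
      · simp [h]
      · have h' : t ∈ r.support := h
        simp [h, PMF.toMeasure_pure]
    rw [hm, integral_finsetSum_measure]
    · unfold PMF.mean
      refine Finset.sum_congr rfl fun t _ => ?_
      rw [integral_smul_measure]
      split_ifs with h
      · rw [integral_dirac, smul_eq_mul]
      · simp
    · intro t _
      refine Integrable.smul_measure ?_ (r.apply_ne_top t)
      split_ifs
      · exact integrable_of_discrete _ hf
      · exact integrable_zero_measure
  rw [integral_bind_fintype _ _ hf]
  refine p.mean_congr fun a _ => ?_
  rw [integral_bind_fintype _ _ hf]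
  exact q.mean_congr fun b _ => hsup _ _

end Operator

/-! ### Laws of Markov chains on infinite paths -/

section Chain

variable {α : Type*} [MeasurableSpace α] [DiscreteMeasurableSpace α] (K : α → PMF α) (a₀ : α)

instance : IsProbabilityMeasure (chainLaw K a₀) := by
  unfold chainLaw; infer_instance

theorem map_eval_zero_chainLaw : (chainLaw K a₀).map (fun ω => ω 0) = Measure.dirac a₀ := by
  unfold chainLaw Kernel.trajMeasure
  have h0 : (fun ω : ℕ → α => ω 0) = (fun x : (Finset.Iic 0 → α) => x ⟨0, by simp⟩) ∘
      Preorder.frestrictLe (π := fun _ => α) 0 := rfl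
  rw [h0, ← Measure.map_map (by fun_prop) (by fun_prop), Measure.map_comp _ _ (by fun_prop),
    Kernel.traj_map_frestrictLe, Kernel.partialTraj_self, Measure.id_comp,
    Measure.map_map (by fun_prop) (by fun_prop)]
  exact Measure.map_dirac _

/-- The Markov property: the kernel sees a finite path only through its last entry, so the
composition-product formula for the path up to `n` and the next point reduces to two coordinates. -/
theorem integral_pair_chainLaw (n : ℕ) {F : α × α → ℝ} (hF : Measurable F) {C : ℝ}
    (hC : ∀ z, |F z| ≤ C) :
    ∫ ω, F (ω n, ω (n + 1)) ∂chainLaw K a₀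
      = ∫ ω, (∫ b, F (ω n, b) ∂(K (ω n)).toMeasure) ∂chainLaw K a₀ := by
  have h := Kernel.map_frestrictLe_trajMeasure_compProd_eq_map_trajMeasure
    (X := fun _ => α) (κ := chainKernel K) (μ₀ := Measure.dirac a₀) (a := n)
  change (chainLaw K a₀).map _ ⊗ₘ _ = (chainLaw K a₀).map _ at h
  set ψ : ((_ : Finset.Iic n) → α) → α := fun x => x ⟨n, Finset.mem_Iic.2 le_rfl⟩ with hψ
  have hψm : Measurable ψ := measurable_pi_apply _
  have hG : Measurable fun z : ((_ : Finset.Iic n) → α) × α => F (ψ z.1, z.2) :=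
    hF.comp ((hψm.comp measurable_fst).prodMk measurable_snd)
  have hpm : Measurable fun ω : ℕ → α => (Preorder.frestrictLe (π := fun _ => α) n ω, ω (n + 1)) :=
    by fun_prop
  calc ∫ ω, F (ω n, ω (n + 1)) ∂chainLaw K a₀
      = ∫ z, F (ψ z.1, z.2) ∂((chainLaw K a₀).map
          (fun ω => (Preorder.frestrictLe (π := fun _ => α) n ω, ω (n + 1)))) := by
        rw [integral_map hpm.aemeasurable hG.aestronglyMeasurable]; rfl
    _ = ∫ x, ∫ b, F (ψ x, b) ∂(K (ψ x)).toMeasure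
          ∂((chainLaw K a₀).map (Preorder.frestrictLe n)) := by
        rw [← h]
        have hpr : IsProbabilityMeasure ((chainLaw K a₀).map
          (Preorder.frestrictLe (π := fun _ => α) n)) :=
          Measure.isProbabilityMeasure_map (by fun_prop)
        rw [Measure.integral_compProd]
        · rfl
        · exact Integrable.of_bound hG.aestronglyMeasurable C
            (Filter.Eventually.of_forall fun z => hC _)
    _ = _ := by
        rw [integral_map (by fun_prop)]
        · rfl
        · have hm := hG.stronglyMeasurable.integral_kernel_prod_right'
            (κ := chainKernel K n)
          exact hm.aestronglyMeasurable

/-- This replaces expectations over infinite paths by iterates of an operator, which are accessible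
to induction. -/
theorem integral_eval_chainLaw {f : α → ℝ} {C : ℝ} (hf : ∀ a, |f a| ≤ C) (n : ℕ) :
    ∫ ω, f (ω n) ∂chainLaw K a₀ = (chainOp K)^[n] f a₀ := by
  induction n generalizing f with
  | zero =>
    have h := integral_map (μ := chainLaw K a₀) (φ := fun ω => ω 0)
      (measurable_pi_apply 0).aemeasurable
      (Measurable.of_discrete (f := f)).aestronglyMeasurable
    rw [map_eval_zero_chainLaw, integral_dirac] at h
    exact h.symm
  | succ n ih =>
    rw [Function.iterate_succ_apply, ← ih (abs_chainOp_le K hf)]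
    exact integral_pair_chainLaw K a₀ n (F := fun z => f z.2)
      ((Measurable.of_discrete (f := f)).comp measurable_snd) (fun z => hf _)

/-- If a label is preserved by the transitions from all points with a label in `Z`, then almost
surely it does not change after `Z` has been reached. -/
theorem ae_label_eq {S : Type*} [Finite S] (st : α → S) (Z : S → Prop)
    (hK : ∀ a, Z (st a) → ∀ b ∈ (K a).support, st b = st a) :
    ∀ᵐ ω ∂chainLaw K a₀, ∀ n, Z (st (ω n)) → st (ω (n + 1)) = st (ω n) := by
  classical
  rw [ae_all_iff]
  intro n
  let _ : MeasurableSpace S := ⊤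
  have hst : Measurable st := Measurable.of_discrete
  -- The indicator of a forbidden change of label. It is nonnegative with integral zero, hence
  -- vanishes almost surely.
  set F₀ : S × S → ℝ := fun z => if Z z.1 → z.2 = z.1 then 0 else 1
  have hF : Measurable fun z : α × α => F₀ (st z.1, st z.2) :=
    (Measurable.of_discrete (f := F₀)).comp
      ((hst.comp measurable_fst).prodMk (hst.comp measurable_snd))
  have hb : ∀ z, |F₀ z| ≤ 1 := by
    intro z; simp only [F₀]; split_ifs <;> simp
  have h := integral_pair_chainLaw K a₀ n hF (C := 1) (fun z => hb _)
  have hz : ∀ a, ∫ b, F₀ (st a, st b) ∂(K a).toMeasure = 0 := by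
    intro a
    refine integral_eq_zero_of_ae ?_
    have : ∀ᵐ b ∂(K a).toMeasure, b ∈ (K a).support := by
      rw [ae_iff, PMF.toMeasure_apply_eq_zero_iff _ (MeasurableSet.of_discrete)]
      exact Set.disjoint_left.2 fun b hb hb' => hb' hb
    filter_upwards [this] with b hb
    exact if_pos fun hZ => hK a hZ b hb
  simp only [hz, integral_zero] at h
  have hm : Measurable fun ω : ℕ → α => F₀ (st (ω n), st (ω (n + 1))) :=
    hF.comp (g := fun z => F₀ (st z.1, st z.2))
      (Measurable.prodMk (f := fun ω : ℕ → α => ω n) (g := fun ω : ℕ → α => ω (n + 1))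
        (measurable_pi_apply n) (measurable_pi_apply (n + 1)))
  rw [integral_eq_zero_iff_of_nonneg] at h
  · filter_upwards [h] with ω hω
    by_contra hne
    simp [F₀, hne] at hω
  · intro ω
    simp only [F₀]
    split_ifs <;> simp
  · exact Integrable.of_bound hm.aestronglyMeasurable 1 (Filter.Eventually.of_forall fun z => hb _)

end Chain

theorem chainOp_congr {α : Type*} [MeasurableSpace α] [DiscreteMeasurableSpace α] {K : α → PMF α}
    {a : α} {f g : α → ℝ} (h : ∀ b ∈ (K a).support, f b = g b) : chainOp K f a = chainOp K g a := by
  refine integral_congr_ae ?_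
  have : ∀ᵐ b ∂(K a).toMeasure, b ∈ (K a).support := by
    rw [ae_iff, PMF.toMeasure_apply_eq_zero_iff _ (MeasurableSet.of_discrete)]
    exact Set.disjoint_left.2 fun b hb hb' => hb' hb
  filter_upwards [this] with b hb using h b hb

theorem chainOp_const {α : Type*} [MeasurableSpace α] (K : α → PMF α) (c : ℝ) (a : α) :
    chainOp K (fun _ => c) a = c := by
  simp [chainOp]

theorem chainOp_mono {α : Type*} [MeasurableSpace α] [DiscreteMeasurableSpace α] (K : α → PMF α)
    {f g : α → ℝ} {C D : ℝ} (hf : ∀ a, |f a| ≤ C) (hg : ∀ a, |g a| ≤ D) (h : ∀ a, f a ≤ g a)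
    (a : α) : chainOp K f a ≤ chainOp K g a :=
  integral_mono (integrable_of_discrete _ hf) (integrable_of_discrete _ hg) h

/-- Two Markov chains that are related by `φ` on a set `R` of points have related expectations. -/
theorem chainOp_iterate_transfer {α β : Type*} [MeasurableSpace α] [MeasurableSpace β]
    {K : α → PMF α} {L : β → PMF β} {φ : α → β} {R : α → Prop} {C : ℝ}
    (h : ∀ a, R a → ∀ (g : α → ℝ) (g' : β → ℝ), (∀ a, |g a| ≤ C) → (∀ b, |g' b| ≤ C) →
      (∀ a, R a → g a = g' (φ a)) → chainOp K g a = chainOp L g' (φ a))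
    {f : α → ℝ} {f' : β → ℝ} (hf : ∀ a, |f a| ≤ C) (hf' : ∀ b, |f' b| ≤ C)
    (hff : ∀ a, R a → f a = f' (φ a)) (n : ℕ) :
    ∀ a, R a → (chainOp K)^[n] f a = (chainOp L)^[n] f' (φ a) := by
  induction n with
  | zero => exact hff
  | succ n ih =>
    intro a ha
    rw [Function.iterate_succ_apply', Function.iterate_succ_apply']
    -- That the first chain does not leave `R` is not a separate hypothesis: it is built into `h`,
    -- which compares `g` and `g'` on `R` only.
    exact h a ha _ _ (abs_chainOp_iterate_le K hf n) (abs_chainOp_iterate_le L hf' n) ih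

namespace RecursiveGame

/-! ### Payoffs as limits over finite horizons -/

section LabelledChain

variable {S : Type*} {A B : S → Type*} (G : RecursiveGame A B)

open Classical in
/-- The payoff if play stays in the state `s`. -/
noncomputable def payoff (r : S → ℝ) (s : S) : ℝ := if G.IsAbsorbing s then r s else 0

open Classical in
/-- The indicator function of the states that are not absorbing. -/
noncomputable def transient (s : S) : ℝ := if G.IsAbsorbing s then 0 else 1

theorem transient_nonneg (s : S) : 0 ≤ G.transient s := by
  unfold transient; split_ifs <;> simp

theorem abs_transient_le (s : S) : |G.transient s| ≤ 1 := by
  unfold transient; split_ifs <;> simp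

theorem exists_abs_payoff_le [Finite S] (r : S → ℝ) : ∃ C, ∀ s, |G.payoff r s| ≤ C := by
  obtain ⟨C, hC⟩ := (Set.finite_range fun s => |G.payoff r s|).bddAbove
  exact ⟨C, fun s => hC ⟨s, rfl⟩⟩

/-- The expected payoff of a Markov chain whose points are labelled with states. -/
noncomputable def chainValue {α : Type*} [MeasurableSpace α] [DiscreteMeasurableSpace α]
    (K : α → PMF α) (st : α → S) (r : S → ℝ) (a : α) : ℝ :=
  ∫ ω, G.evaluate r (fun n => st (ω n)) ∂chainLaw K a

/-- The transitions do not change a label that is an absorbing state. -/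
def Respects {α : Type*} (K : α → PMF α) (st : α → S) : Prop :=
  ∀ a, G.IsAbsorbing (st a) → ∀ b ∈ (K a).support, st b = st a

variable {G}

theorem label_eq_of_le {path : ℕ → S}
    (h : ∀ n, G.IsAbsorbing (path n) → path (n + 1) = path n) {k : ℕ} (hk : G.IsAbsorbing (path k))
    {m : ℕ} (hm : k ≤ m) : path m = path k := by
  induction m, hm using Nat.le_induction with
  | base => rfl
  | succ m hm ih => rw [h m (ih ▸ hk), ih]

variable {α : Type*} [MeasurableSpace α] [DiscreteMeasurableSpace α]
  {K : α → PMF α} {st : α → S}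

-- An absorbing label is frozen, so almost surely the payoff at time `n` is eventually the
-- evaluation of the path, and dominated convergence applies. The later properties of `chainValue`
-- are read off from this limit.
open Classical in
theorem Respects.tendsto_payoff [Finite S] (hK : G.Respects K st) (r : S → ℝ) (a : α) :
    Filter.Tendsto (fun n => (chainOp K)^[n] (fun b => G.payoff r (st b)) a) Filter.atTop
      (nhds (G.chainValue K st r a)) := by
  obtain ⟨C, hC⟩ := G.exists_abs_payoff_le r
  have h : ∀ n, (chainOp K)^[n] (fun b => G.payoff r (st b)) a
      = ∫ ω, G.payoff r (st (ω n)) ∂chainLaw K a := fun n =>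
    (integral_eval_chainLaw K a (f := fun b => G.payoff r (st b)) (fun b => hC _) n).symm
  simp only [h]
  refine tendsto_integral_of_dominated_convergence (fun _ => C) (fun n => ?_) (integrable_const C)
    (fun n => Filter.Eventually.of_forall fun ω => hC _) ?_
  · exact ((Measurable.of_discrete (f := fun b => G.payoff r (st b))).comp
      (measurable_pi_apply n)).aestronglyMeasurable
  · filter_upwards [ae_label_eq K a st G.IsAbsorbing hK] with ω hω
    unfold evaluate
    split_ifs with hex
    · refine tendsto_const_nhds.congr' ?_
      filter_upwards [Filter.eventually_ge_atTop (Nat.find hex)] with m hm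
      have hs := Nat.find_spec hex
      rw [label_eq_of_le (path := fun n => st (ω n)) hω hs hm, payoff, if_pos hs]
    · refine tendsto_const_nhds.congr fun n => ?_
      rw [payoff, if_neg fun hn => hex ⟨n, hn⟩]

/-- The bound `n + 1` in the event is strict, so time `n` belongs to it and `n` iterations suffice.
-/
theorem chainLaw_not_absorbed_le (K : α → PMF α) (st : α → S) (a : α) (n : ℕ) :
    chainLaw K a {ω | ∀ m < n + 1, ¬ G.IsAbsorbing (st (ω m))}
      ≤ ENNReal.ofReal ((chainOp K)^[n] (fun b => G.transient (st b)) a) := by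
  have hm : MeasurableSet {ω : ℕ → α | ¬ G.IsAbsorbing (st (ω n))} :=
    measurable_pi_apply (X := fun _ : ℕ => α) n
      (MeasurableSet.of_discrete (s := {b | ¬ G.IsAbsorbing (st b)}))
  have h : ∫ ω, G.transient (st (ω n)) ∂chainLaw K a
      = (chainLaw K a).real {ω | ¬ G.IsAbsorbing (st (ω n))} := by
    rw [← integral_indicator_one hm]
    congr 1
    funext ω
    by_cases hω : G.IsAbsorbing (st (ω n)) <;> simp [transient, hω]
  rw [← integral_eval_chainLaw K a (f := fun b => G.transient (st b))
    (fun b => G.abs_transient_le _) n, h, ofReal_measureReal]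
  exact measure_mono fun ω hω => hω n (Nat.lt_succ_self n)

theorem Respects.tendsto_transient [Finite S] (hK : G.Respects K st) {a : α}
    (h : ∀ᵐ ω ∂chainLaw K a, ∃ n, G.IsAbsorbing (st (ω n))) :
    Filter.Tendsto (fun n => (chainOp K)^[n] (fun b => G.transient (st b)) a) Filter.atTop
      (nhds 0) := by
  have h' : ∀ n, (chainOp K)^[n] (fun b => G.transient (st b)) a
      = ∫ ω, G.transient (st (ω n)) ∂chainLaw K a := fun n =>
    (integral_eval_chainLaw K a (f := fun b => G.transient (st b))
      (fun b => G.abs_transient_le _) n).symm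
  simp only [h']
  rw [← integral_zero (ℕ → α) ℝ (μ := chainLaw K a)]
  refine tendsto_integral_of_dominated_convergence (fun _ => 1) (fun n => ?_) (integrable_const 1)
    (fun n => Filter.Eventually.of_forall fun ω => G.abs_transient_le _) ?_
  · exact ((Measurable.of_discrete (f := fun b => G.transient (st b))).comp
      (measurable_pi_apply n)).aestronglyMeasurable
  · filter_upwards [ae_label_eq K a st G.IsAbsorbing hK, h] with ω hω hex
    obtain ⟨k, hk⟩ := hex
    refine tendsto_const_nhds.congr' ?_
    filter_upwards [Filter.eventually_ge_atTop k] with m hm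
    rw [label_eq_of_le (path := fun n => st (ω n)) hω hk hm, transient, if_pos hk]

theorem ae_absorbed_of_tendsto {a : α}
    (h : Filter.Tendsto (fun n => (chainOp K)^[n] (fun b => G.transient (st b)) a) Filter.atTop
      (nhds 0)) : ∀ᵐ ω ∂chainLaw K a, ∃ n, G.IsAbsorbing (st (ω n)) := by
  rw [ae_iff]
  have h' := ENNReal.tendsto_ofReal h
  rw [ENNReal.ofReal_zero] at h'
  refine le_antisymm (ge_of_tendsto' h' fun n => ?_) zero_le
  refine le_trans (measure_mono ?_) (chainLaw_not_absorbed_le K st a n)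
  exact fun ω hω m _ hm => hω ⟨m, hm⟩

theorem Respects.chainValue_eq_op [Finite S] (hK : G.Respects K st) (r : S → ℝ) (a : α) :
    G.chainValue K st r a = chainOp K (G.chainValue K st r) a := by
  obtain ⟨C, hC⟩ := G.exists_abs_payoff_le r
  have h₁ := (Filter.tendsto_add_atTop_iff_nat 1).2 (hK.tendsto_payoff r a)
  simp only [Function.iterate_succ_apply'] at h₁
  exact tendsto_nhds_unique h₁ (tendsto_chainOp K
    (fun n => abs_chainOp_iterate_le K (fun b => hC (st b)) n) (hK.tendsto_payoff r) a)

theorem Respects.abs_chainValue_le [Finite S] (hK : G.Respects K st) {r : S → ℝ} {C : ℝ}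
    (hC : ∀ s, |G.payoff r s| ≤ C) (a : α) : |G.chainValue K st r a| ≤ C :=
  le_of_tendsto' (hK.tendsto_payoff r a).abs fun n =>
    abs_chainOp_iterate_le K (fun b => hC (st b)) n a

theorem Respects.le_chainValue [Finite S] (hK : G.Respects K st) {r : S → ℝ} {c : ℝ}
    (hc : ∀ s, c ≤ G.payoff r s) (a : α) : c ≤ G.chainValue K st r a := by
  obtain ⟨C, hC⟩ := G.exists_abs_payoff_le r
  refine ge_of_tendsto' (hK.tendsto_payoff r a) fun n => ?_
  have hn : ∀ n b, c ≤ (chainOp K)^[n] (fun b => G.payoff r (st b)) b := by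
    intro n
    induction n with
    | zero => exact fun b => hc _
    | succ n ih =>
      intro b
      rw [Function.iterate_succ_apply', ← chainOp_const K c b]
      exact chainOp_mono K (fun _ => le_rfl) (abs_chainOp_iterate_le K (fun b => hC (st b)) n) ih b
  exact hn n a

theorem Respects.chainValue_of_isAbsorbing [Finite S] (hK : G.Respects K st) (r : S → ℝ) {a : α}
    (ha : G.IsAbsorbing (st a)) : G.chainValue K st r a = r (st a) := by
  have hn : ∀ n a, G.IsAbsorbing (st a) →
      (chainOp K)^[n] (fun b => G.payoff r (st b)) a = r (st a) := by
    intro n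
    induction n with
    | zero => exact fun a ha => if_pos ha
    | succ n ih =>
      intro a ha
      rw [Function.iterate_succ_apply', ← chainOp_const K (r (st a)) a]
      refine chainOp_congr fun b hb => ?_
      have hb' := hK a ha b hb
      rw [ih b (hb' ▸ ha), hb']
  refine tendsto_nhds_unique (hK.tendsto_payoff r a) ?_
  simp only [hn _ a ha]
  exact tendsto_const_nhds

/-- The finite-horizon expectations of the two chains agree, hence so do their limits. -/
theorem Respects.chainValue_transfer [Finite S] {β : Type*} [MeasurableSpace β]
    [DiscreteMeasurableSpace β] {L : β → PMF β} {st' : β → S} (hK : G.Respects K st)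
    (hL : G.Respects L st') {φ : α → β} {R : α → Prop} (r : S → ℝ)
    (hst : ∀ a, R a → st a = st' (φ a))
    (h : ∀ C a, R a → ∀ (g : α → ℝ) (g' : β → ℝ), (∀ a, |g a| ≤ C) → (∀ b, |g' b| ≤ C) →
      (∀ a, R a → g a = g' (φ a)) → chainOp K g a = chainOp L g' (φ a)) {a : α} (ha : R a) :
    G.chainValue K st r a = G.chainValue L st' r (φ a) := by
  obtain ⟨C, hC⟩ := G.exists_abs_payoff_le r
  refine tendsto_nhds_unique (hK.tendsto_payoff r a) ((hL.tendsto_payoff r (φ a)).congr fun n => ?_)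
  exact (chainOp_iterate_transfer (h C) (fun b => hC (st b)) (fun b => hC (st' b))
    (fun b hb => by rw [hst b hb]) n a ha).symm

end LabelledChain

end RecursiveGame

namespace RecursiveGame

universe u v w

variable {S : Type u} {A : S → Type v} {B : S → Type w} (G : RecursiveGame A B)

/-! ### Continuation payoffs after a history -/

section Histories

variable {G} in
theorem state_eq_of_mem_support_stage {α : Type*} {st : α → S} {s : S} {p : PMF (A s)}
    {q : PMF (B s)} {φ : ∀ a b t, t ∈ (G.trans s a b).support → α}
    (hφ : ∀ a b t ht, st (φ a b t ht) = t) (hs : G.IsAbsorbing s) {c : α}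
    (hc : c ∈ (p.bind fun a => q.bind fun b =>
      (G.trans s a b).bindOnSupport fun t ht => PMF.pure (φ a b t ht)).support) : st c = s := by
  rw [PMF.mem_support_bind_iff] at hc
  obtain ⟨a, -, hc⟩ := hc
  rw [PMF.mem_support_bind_iff] at hc
  obtain ⟨b, -, hc⟩ := hc
  rw [PMF.mem_support_bindOnSupport_iff] at hc
  obtain ⟨t, ht, hc⟩ := hc
  rw [PMF.mem_support_pure_iff] at hc
  rw [hc, hφ]
  rw [hs a b, PMF.mem_support_pure_iff] at ht
  exact ht

theorem respects_playStep (σ₁ : G.Strategy₁) (σ₂ : G.Strategy₂) :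
    G.Respects (G.playStep σ₁ σ₂) AnyHist.state :=
  fun _ hh _ hk => state_eq_of_mem_support_stage (fun _ _ _ _ => rfl) hh hk

/-- The expected payoff after a history. -/
noncomputable def histValue (σ₁ : G.Strategy₁) (σ₂ : G.Strategy₂) (r : S → ℝ) ⦃s : S⦄
    (h : G.Hist s) : ℝ :=
  G.chainValue (G.playStep σ₁ σ₂) AnyHist.state r ⟨s, h⟩

open Classical in
variable {G} in
/-- The history `k`, preceded by `h` if `k` begins in the state in which `h` ends. -/
noncomputable def Hist.graft {t : S} (h : G.Hist t) : ∀ {s : S}, G.Hist s → G.Hist s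
  | _, .start s => if e : t = s then e ▸ h else .start s
  | _, .snoc k a b ht => .snoc (graft h k) a b ht

variable {G} in
theorem Hist.graft_start {t : S} (h : G.Hist t) : h.graft (.start t) = h := by
  simp [Hist.graft]

variable [Fintype S] [∀ s, Fintype (A s)] [∀ s, Fintype (B s)]

/-- The expectation at the next stage after the history `h`. -/
noncomputable def stageMean {s : S} (h : G.Hist s) (a : A s) (b : B s)
    (f : ∀ ⦃t : S⦄, G.Hist t → ℝ) : ℝ :=
  (G.trans s a b).mean fun _ ht => f (h.snoc a b ht)

theorem chainOp_playStep (σ₁ : G.Strategy₁) (σ₂ : G.Strategy₂) {f : G.AnyHist → ℝ} {C : ℝ}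
    (hf : ∀ h, |f h| ≤ C) (h : G.AnyHist) :
    chainOp (G.playStep σ₁ σ₂) f h = (σ₁ h.hist).mean fun a _ => (σ₂ h.hist).mean fun b _ =>
      (G.trans h.state a b).mean fun t ht => f ⟨t, h.hist.snoc a b ht⟩ :=
  integral_stage _ _ _ _ hf

variable {G}

theorem histValue_eq (σ₁ : G.Strategy₁) (σ₂ : G.Strategy₂) (r : S → ℝ) {s : S} (h : G.Hist s) :
    G.histValue σ₁ σ₂ r h = (σ₁ h).mean fun a _ => (σ₂ h).mean fun b _ =>
      G.stageMean h a b (G.histValue σ₁ σ₂ r) := by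
  obtain ⟨C, hC⟩ := G.exists_abs_payoff_le r
  have hK := G.respects_playStep σ₁ σ₂
  unfold histValue
  rw [hK.chainValue_eq_op, chainOp_playStep G σ₁ σ₂ (hK.abs_chainValue_le hC)]
  rfl

/-- Grafting commutes with appending a stage, so it carries the play from `t` to the continuation
after `h`. As `Hist.graft` is total, this needs no restriction on the histories. -/
theorem histValue_graft (σ₁ : G.Strategy₁) (σ₂ : G.Strategy₂) (r : S → ℝ) {t : S} (h : G.Hist t) :
    G.histValue σ₁ σ₂ r h = G.histValue (fun _ k => σ₁ (h.graft k)) (fun _ k => σ₂ (h.graft k)) r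
      (.start t) := by
  have := (G.respects_playStep (fun _ k => σ₁ (h.graft k))
    (fun _ k => σ₂ (h.graft k))).chainValue_transfer (G.respects_playStep σ₁ σ₂)
    (φ := fun k => ⟨k.state, h.graft k.hist⟩) (R := fun _ => True) r (fun _ _ => rfl)
    (fun C k _ g g' hg hg' hgg => by
      rw [chainOp_playStep G _ _ hg, chainOp_playStep G _ _ hg']
      simp only [hgg _ trivial, Hist.graft]) (a := ⟨t, .start t⟩) trivial
  simp only [Hist.graft_start] at this
  exact this.symm

/-- The root of a history never changes, so only histories rooted at `t` can occur. -/
theorem histValue_congr {σ₁ σ₁' : G.Strategy₁} {σ₂ σ₂' : G.Strategy₂} (r : S → ℝ) {t : S}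
    (h₁ : ∀ ⦃s⦄ (k : G.Hist s), k.root = t → σ₁ k = σ₁' k)
    (h₂ : ∀ ⦃s⦄ (k : G.Hist s), k.root = t → σ₂ k = σ₂' k) :
    G.histValue σ₁ σ₂ r (.start t) = G.histValue σ₁' σ₂' r (.start t) :=
  (G.respects_playStep σ₁ σ₂).chainValue_transfer (G.respects_playStep σ₁' σ₂')
    (φ := id) (R := fun k => k.hist.root = t) r (fun _ _ => rfl)
    (fun C k hk g g' hg hg' hgg => by
      rw [chainOp_playStep G _ _ hg, chainOp_playStep G _ _ hg', h₁ _ hk, h₂ _ hk]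
      refine PMF.mean_congr _ fun a _ => PMF.mean_congr _ fun b _ => PMF.mean_congr _ fun t ht => ?_
      exact hgg ⟨t, k.hist.snoc a b ht⟩ hk) (a := ⟨t, .start t⟩) rfl

theorem histValue_of_isAbsorbing (σ₁ : G.Strategy₁) (σ₂ : G.Strategy₂) (r : S → ℝ) {s : S}
    (hs : G.IsAbsorbing s) (h : G.Hist s) : G.histValue σ₁ σ₂ r h = r s :=
  (G.respects_playStep σ₁ σ₂).chainValue_of_isAbsorbing r (a := ⟨s, h⟩) hs

theorem le_histValue (σ₁ : G.Strategy₁) (σ₂ : G.Strategy₂) {r : S → ℝ} {c : ℝ}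
    (hc : ∀ s, c ≤ G.payoff r s) {s : S} (h : G.Hist s) : c ≤ G.histValue σ₁ σ₂ r h :=
  (G.respects_playStep σ₁ σ₂).le_chainValue hc _

theorem V₁_eq (s : S) (σ₁ : G.Strategy₁) (σ₂ : G.Strategy₂) :
    G.V₁ s σ₁ σ₂ = G.histValue σ₁ σ₂ G.r₁ (.start s) := rfl

theorem V₂_eq (s : S) (σ₁ : G.Strategy₁) (σ₂ : G.Strategy₂) :
    G.V₂ s σ₁ σ₂ = G.histValue σ₁ σ₂ G.r₂ (.start s) := rfl

theorem exists_abs_V₁_le : ∃ C, ∀ s (σ₁ : G.Strategy₁) (σ₂ : G.Strategy₂), |G.V₁ s σ₁ σ₂| ≤ C := by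
  obtain ⟨C, hC⟩ := G.exists_abs_payoff_le G.r₁
  exact ⟨C, fun s σ₁ σ₂ => (G.respects_playStep σ₁ σ₂).abs_chainValue_le hC _⟩

theorem exists_abs_V₂_le : ∃ C, ∀ s (σ₁ : G.Strategy₁) (σ₂ : G.Strategy₂), |G.V₂ s σ₁ σ₂| ≤ C := by
  obtain ⟨C, hC⟩ := G.exists_abs_payoff_le G.r₂
  exact ⟨C, fun s σ₁ σ₂ => (G.respects_playStep σ₁ σ₂).abs_chainValue_le hC _⟩

end Histories

/-! ### Punishing strategies and the min-max values -/

section Punishment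

/-- The infimum in the min-max value of a bounded function is attained up to `ε`. -/
theorem exists_forall_le_ciInf_ciSup_add {X Y : Type*} [Nonempty X] {f : X → Y → ℝ} {C : ℝ}
    (hf : ∀ x y, |f x y| ≤ C) {ε : ℝ} (hε : 0 < ε) :
    ∃ x, ∀ y, f x y ≤ (⨅ x, ⨆ y, f x y) + ε := by
  obtain ⟨x, hx⟩ := exists_lt_of_ciInf_lt (f := fun x => ⨆ y, f x y)
    (lt_add_of_pos_right (⨅ x, ⨆ y, f x y) hε)
  have hb : BddAbove (Set.range (f x)) :=
    ⟨C, by rintro _ ⟨y, rfl⟩; exact (abs_le.1 (hf x y)).2⟩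
  exact ⟨x, fun y => (le_ciSup hb y).trans hx.le⟩

theorem ciInf_ciSup_le {X Y : Type*} [Nonempty Y] {f : X → Y → ℝ} {C : ℝ}
    (hf : ∀ x y, |f x y| ≤ C) (x : X) {c : ℝ} (h : ∀ y, f x y ≤ c) : (⨅ x, ⨆ y, f x y) ≤ c := by
  have hb : ∀ x, BddAbove (Set.range (f x)) := fun x =>
    ⟨C, by rintro _ ⟨y, rfl⟩; exact (abs_le.1 (hf x y)).2⟩
  refine (ciInf_le (f := fun x => ⨆ y, f x y) ⟨-C, ?_⟩ x).trans (ciSup_le h)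
  rintro _ ⟨x, rfl⟩
  have y : Y := Classical.arbitrary Y
  exact (abs_le.1 (hf x y)).1.trans (le_ciSup (hb x) y)

variable [Fintype S] [∀ s, Fintype (A s)] [∀ s, Fintype (B s)]
  [∀ s, Nonempty (A s)] [∀ s, Nonempty (B s)]

instance : Nonempty G.Strategy₁ := ⟨fun s _ => PMF.pure (Classical.arbitrary (A s))⟩

instance : Nonempty G.Strategy₂ := ⟨fun s _ => PMF.pure (Classical.arbitrary (B s))⟩

/-- Near-optimal strategies exist for each start separately; the root of the history tells which of
them to use. -/
theorem exists_punishing₂ {ε : ℝ} (hε : 0 < ε) :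
    ∃ τ₂ : G.Strategy₂, ∀ s (σ₁ : G.Strategy₁), G.V₁ s σ₁ τ₂ ≤ G.c₁ s + ε := by
  obtain ⟨C, hC⟩ := G.exists_abs_V₁_le
  have h : ∀ s, ∃ τ : G.Strategy₂, ∀ σ₁, G.V₁ s σ₁ τ ≤ G.c₁ s + ε := fun s =>
    exists_forall_le_ciInf_ciSup_add (fun τ σ₁ => hC s σ₁ τ) hε
  choose τ hτ using h
  refine ⟨fun _ k => τ k.root k, fun s σ₁ => le_trans (le_of_eq ?_) (hτ s σ₁)⟩
  exact histValue_congr _ (fun _ _ _ => rfl) fun _ k hk => by rw [hk]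

theorem exists_punishing₁ {ε : ℝ} (hε : 0 < ε) :
    ∃ τ₁ : G.Strategy₁, ∀ s (σ₂ : G.Strategy₂), G.V₂ s τ₁ σ₂ ≤ G.c₂ s + ε := by
  obtain ⟨C, hC⟩ := G.exists_abs_V₂_le
  have h : ∀ s, ∃ τ : G.Strategy₁, ∀ σ₂, G.V₂ s τ σ₂ ≤ G.c₂ s + ε := fun s =>
    exists_forall_le_ciInf_ciSup_add (fun τ σ₂ => hC s τ σ₂) hε
  choose τ hτ using h
  refine ⟨fun _ k => τ k.root k, fun s σ₁ => le_trans (le_of_eq ?_) (hτ s σ₁)⟩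
  exact histValue_congr _ (fun _ k hk => by rw [hk]) fun _ _ _ => rfl

variable {G} {β₁ : G.Strategy₁} {β₂ : G.Strategy₂}
  {g₁ : ∀ ⦃s : S⦄, G.Hist s → A s → ℝ} {g₂ : ∀ ⦃s : S⦄, G.Hist s → B s → ℝ}
  {ε ε' : ℝ} {deadline : S → ℕ} {τ₁ : G.Strategy₁} {τ₂ : G.Strategy₂}

/-- Right after a failure the game restarts: along grafted histories the prescribed strategy is just
the punishing one. -/
theorem sinceFailure_graft {t : S} {h : G.Hist t}
    (hh : G.sinceFailure β₁ β₂ g₁ g₂ ε deadline h = some (.start t)) :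
    ∀ {s : S} (k : G.Hist s), k.root = t →
      G.sinceFailure β₁ β₂ g₁ g₂ ε deadline (h.graft k) = some k
  | _, .start s, hk => by
    obtain rfl : s = t := hk
    rw [Hist.graft_start, hh]
  | _, .snoc k a b ht, hk => by
    have := sinceFailure_graft hh k hk
    simp only [Hist.graft, sinceFailure, this]

theorem histValue_le_c₁_of_failure (hτ : ∀ s (σ₁ : G.Strategy₁), G.V₁ s σ₁ τ₂ ≤ G.c₁ s + ε')
    {t : S} {h : G.Hist t} (hh : G.sinceFailure β₁ β₂ g₁ g₂ ε deadline h = some (.start t))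
    (σ₁ : G.Strategy₁) :
    G.histValue σ₁ (G.testAndPunish₂ β₁ β₂ g₁ g₂ ε deadline τ₂) G.r₁ h ≤ G.c₁ t + ε' := by
  rw [histValue_graft, histValue_congr G.r₁ (fun _ _ _ => rfl) (σ₂' := τ₂)]
  · exact hτ t _
  · intro s k hk
    simp only [testAndPunish₂, sinceFailure_graft hh k hk]

theorem histValue_le_c₂_of_failure (hτ : ∀ s (σ₂ : G.Strategy₂), G.V₂ s τ₁ σ₂ ≤ G.c₂ s + ε')
    {t : S} {h : G.Hist t} (hh : G.sinceFailure β₁ β₂ g₁ g₂ ε deadline h = some (.start t))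
    (σ₂ : G.Strategy₂) :
    G.histValue (G.testAndPunish₁ β₁ β₂ g₁ g₂ ε deadline τ₁) σ₂ G.r₂ h ≤ G.c₂ t + ε' := by
  rw [histValue_graft, histValue_congr G.r₂ (σ₁' := τ₁) _ (fun _ _ _ => rfl)]
  · exact hτ t _
  · intro s k hk
    simp only [testAndPunish₁, sinceFailure_graft hh k hk]

theorem mean_c₁_le_jump₁ {s : S} (y : PMF (B s)) (a : A s) :
    (y.mean fun b _ => (G.trans s a b).mean fun t _ => G.c₁ t) ≤ G.jump₁ s y := by
  rw [PMF.mean_eq_sum y fun b => (G.trans s a b).mean fun t _ => G.c₁ t]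
  simp only [PMF.mean_eq_sum]
  exact le_ciSup (f := fun a => ∑ b, (y b).toReal * G.next G.c₁ s a b)
    (Set.finite_range _).bddAbove a

theorem mean_c₂_le_jump₂ {s : S} (x : PMF (A s)) (b : B s) :
    (x.mean fun a _ => (G.trans s a b).mean fun t _ => G.c₂ t) ≤ G.jump₂ s x := by
  rw [PMF.mean_eq_sum x fun a => (G.trans s a b).mean fun t _ => G.c₂ t]
  simp only [PMF.mean_eq_sum]
  exact le_ciSup (f := fun b => ∑ a, (x a).toReal * G.next G.c₂ s a b)
    (Set.finite_range _).bddAbove b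

theorem sinceFailure_snoc_of_not_passes {s t : S} {h : G.Hist s}
    (hh : G.sinceFailure β₁ β₂ g₁ g₂ ε deadline h = none) {a : A s} {b : B s}
    (ht : t ∈ (G.trans s a b).support) (hp : ¬ G.Passes β₁ β₂ g₁ g₂ ε deadline h a b) :
    G.sinceFailure β₁ β₂ g₁ g₂ ε deadline (h.snoc a b ht) = some (.start t) := by
  simp only [sinceFailure, hh, if_neg hp]

theorem sinceFailure_snoc_of_passes {s t : S} {h : G.Hist s}
    (hh : G.sinceFailure β₁ β₂ g₁ g₂ ε deadline h = none) {a : A s} {b : B s}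
    (ht : t ∈ (G.trans s a b).support) (hp : G.Passes β₁ β₂ g₁ g₂ ε deadline h a b) :
    G.sinceFailure β₁ β₂ g₁ g₂ ε deadline (h.snoc a b ht) = none := by
  simp only [sinceFailure, hh, if_pos hp]

/-- Player Two can play an arbitrary mixed move at the first stage and punish from then on. -/
theorem c₁_le_jump₁ (s : S) (y : PMF (B s)) : G.c₁ s ≤ G.jump₁ s y := by
  classical
  refine le_of_forall_pos_le_add fun e he => ?_
  obtain ⟨C, hC⟩ := G.exists_abs_V₁_le
  obtain ⟨τ₂, hτ⟩ := G.exists_punishing₂ he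
  obtain ⟨α₁⟩ : Nonempty G.Strategy₁ := inferInstance
  obtain ⟨α₂⟩ : Nonempty G.Strategy₂ := inferInstance
  let γ : G.Strategy₂ := fun t k => if e : s = t then e ▸ y else α₂ k
  -- With zero scores and tolerance `-1` the very first test fails. This strategy therefore plays
  -- `y` once and punishes from the next stage on.
  refine ciInf_ciSup_le (fun σ₂ σ₁ => hC s σ₁ σ₂)
    (G.testAndPunish₂ α₁ γ (fun _ _ _ => 0) (fun _ _ _ => 0) (-1) (fun _ => 0) τ₂) fun σ₁ => ?_
  rw [V₁_eq, histValue_eq]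
  have hγ : G.testAndPunish₂ α₁ γ (fun _ _ _ => 0) (fun _ _ _ => 0) (-1) (fun _ => 0) τ₂
      (.start s) = y := by
    simp [testAndPunish₂, sinceFailure, γ]
  rw [hγ]
  refine (PMF.mean_mono _ fun a _ => ?_).trans (PMF.mean_const (σ₁ (.start s)) _).le
  have h₁ : ∀ b, G.stageMean (.start s) a b (G.histValue σ₁ (G.testAndPunish₂ α₁ γ (fun _ _ _ => 0)
      (fun _ _ _ => 0) (-1) (fun _ => 0) τ₂) G.r₁)
      ≤ ((G.trans s a b).mean fun t _ => G.c₁ t) + e := by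
    intro b
    rw [← PMF.mean_const (G.trans s a b) e, ← PMF.mean_add]
    refine PMF.mean_mono _ fun t ht => histValue_le_c₁_of_failure hτ ?_ σ₁
    refine sinceFailure_snoc_of_not_passes rfl ht fun hp => ?_
    have := hp.2.2.2.1
    simp only [score₁] at this
    linarith
  refine (PMF.mean_mono y fun b _ => h₁ b).trans ?_
  rw [PMF.mean_add, PMF.mean_const]
  linarith [G.mean_c₁_le_jump₁ y a]

/-- Player One can play an arbitrary mixed move at the first stage and punish from then on. -/
theorem c₂_le_jump₂ (s : S) (x : PMF (A s)) : G.c₂ s ≤ G.jump₂ s x := by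
  classical
  refine le_of_forall_pos_le_add fun e he => ?_
  obtain ⟨C, hC⟩ := G.exists_abs_V₂_le
  obtain ⟨τ₁, hτ⟩ := G.exists_punishing₁ he
  obtain ⟨α₁⟩ : Nonempty G.Strategy₁ := inferInstance
  obtain ⟨α₂⟩ : Nonempty G.Strategy₂ := inferInstance
  let γ : G.Strategy₁ := fun t k => if e : s = t then e ▸ x else α₁ k
  refine ciInf_ciSup_le (fun σ₁ σ₂ => hC s σ₁ σ₂)
    (G.testAndPunish₁ γ α₂ (fun _ _ _ => 0) (fun _ _ _ => 0) (-1) (fun _ => 0) τ₁) fun σ₂ => ?_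
  rw [V₂_eq, histValue_eq]
  have hγ : G.testAndPunish₁ γ α₂ (fun _ _ _ => 0) (fun _ _ _ => 0) (-1) (fun _ => 0) τ₁
      (.start s) = x := by
    simp [testAndPunish₁, sinceFailure, γ]
  rw [hγ, PMF.mean_comm]
  refine (PMF.mean_mono _ fun b _ => ?_).trans (PMF.mean_const (σ₂ (.start s)) _).le
  have h₁ : ∀ a, G.stageMean (.start s) a b (G.histValue (G.testAndPunish₁ γ α₂ (fun _ _ _ => 0)
      (fun _ _ _ => 0) (-1) (fun _ => 0) τ₁) σ₂ G.r₂)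
      ≤ ((G.trans s a b).mean fun t _ => G.c₂ t) + e := by
    intro a
    rw [← PMF.mean_const (G.trans s a b) e, ← PMF.mean_add]
    refine PMF.mean_mono _ fun t ht => histValue_le_c₂_of_failure hτ ?_ σ₂
    refine sinceFailure_snoc_of_not_passes rfl ht fun hp => ?_
    have := hp.2.2.2.1
    simp only [score₁] at this
    linarith
  refine (PMF.mean_mono x fun a _ => h₁ a).trans ?_
  rw [PMF.mean_add, PMF.mean_const]
  linarith [G.mean_c₂_le_jump₂ x b]

end Punishment

end RecursiveGame

namespace RecursiveGame

universe u v w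

variable {S : Type u} {A : S → Type v} {B : S → Type w} {G : RecursiveGame A B}
  [Fintype S] [∀ s, Fintype (A s)] [∀ s, Fintype (B s)]
  [∀ s, Nonempty (A s)] [∀ s, Nonempty (B s)]
  {β₁ : G.Strategy₁} {β₂ : G.Strategy₂}
  {g₁ : ∀ ⦃s : S⦄, G.Hist s → A s → ℝ} {g₂ : ∀ ⦃s : S⦄, G.Hist s → B s → ℝ}
  {ε ε' : ℝ} {deadline : S → ℕ} {τ₁ : G.Strategy₁} {τ₂ : G.Strategy₂}

/-! ### Upper bounds for a deviating player -/

section Deviation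

/-- Against testing and punishment Player One cannot gain much from a deviation, whatever her
remaining tolerance is. -/
theorem histValue_deviation₁_le {v₁ : ∀ ⦃s : S⦄, G.Hist s → ℝ}
    (hτ : ∀ s (σ₁ : G.Strategy₁), G.V₁ s σ₁ τ₂ ≤ G.c₁ s + ε')
    (hv : ∀ ⦃s⦄ (h : G.Hist s), G.jump₁ s (β₂ h) - ε ≤ v₁ h)
    (hg : ∀ ⦃s⦄ (h : G.Hist s) a, g₁ h a = ((β₂ h).mean fun b _ => G.stageMean h a b v₁) - v₁ h)
    (σ₁ : G.Strategy₁) (m : ℕ) :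
    ∀ {s : S} (h : G.Hist s), G.sinceFailure β₁ β₂ g₁ g₂ ε deadline h = none →
      deadline h.root + 1 ≤ h.stage + m → G.score₁ g₁ h ≤ ε →
      G.histValue σ₁ (G.testAndPunish₂ β₁ β₂ g₁ g₂ ε deadline τ₂) G.r₁ h
        ≤ v₁ h - G.score₁ g₁ h + (2 * ε + ε') := by
  -- One stage of the backward induction. For a fixed move `a`, averaging over Player Two's mixed
  -- move adds `g₁ h a` both to the mean of `v₁` and to the score, so their difference is preserved.
  have hone : ∀ {s : S} (h : G.Hist s), G.sinceFailure β₁ β₂ g₁ g₂ ε deadline h = none →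
      G.score₁ g₁ h ≤ ε →
      (∀ a b t (ht : t ∈ (G.trans s a b).support), G.Passes β₁ β₂ g₁ g₂ ε deadline h a b →
        G.histValue σ₁ (G.testAndPunish₂ β₁ β₂ g₁ g₂ ε deadline τ₂) G.r₁ (h.snoc a b ht)
          ≤ v₁ (h.snoc a b ht) - G.score₁ g₁ (h.snoc a b ht) + (2 * ε + ε')) →
      G.histValue σ₁ (G.testAndPunish₂ β₁ β₂ g₁ g₂ ε deadline τ₂) G.r₁ h
        ≤ v₁ h - G.score₁ g₁ h + (2 * ε + ε') := by
    intro s h hh hs hnext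
    rw [histValue_eq]
    have hβ : G.testAndPunish₂ β₁ β₂ g₁ g₂ ε deadline τ₂ h = β₂ h := by
      simp only [testAndPunish₂, hh]
    rw [hβ]
    refine (PMF.mean_mono _ fun a _ => ?_).trans (PMF.mean_const (σ₁ h) _).le
    -- If her own part of the test is passed, the new score is at most `ε`, and a failure can be
    -- absorbed at the next state. Otherwise every continuation is punished, and the jump function
    -- at `h` bounds the mean directly.
    by_cases ha : a ∈ (β₁ h).support ∧ G.score₁ g₁ h + g₁ h a ≤ ε
    · have hb : ∀ b, G.stageMean h a b (G.histValue σ₁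
          (G.testAndPunish₂ β₁ β₂ g₁ g₂ ε deadline τ₂) G.r₁) ≤
          G.stageMean h a b v₁ + (2 * ε + ε' - (G.score₁ g₁ h + g₁ h a)) := by
        intro b
        unfold stageMean
        rw [← PMF.mean_const (G.trans s a b) (2 * ε + ε' - _), ← PMF.mean_add]
        refine PMF.mean_mono _ fun t ht => ?_
        by_cases hp : G.Passes β₁ β₂ g₁ g₂ ε deadline h a b
        · have := hnext a b t ht hp
          simp only [score₁] at this
          linarith
        -- Punishment pays at most `v₁ + ε + ε'` at the new history; since the new score is at most
        -- `ε`, the remaining `ε` of the allowance covers its subtraction.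
        · have h₁ := histValue_le_c₁_of_failure hτ (sinceFailure_snoc_of_not_passes hh ht hp) σ₁
          have h₂ := G.c₁_le_jump₁ t (β₂ (h.snoc a b ht))
          have h₃ := hv (h.snoc a b ht)
          linarith [ha.2]
      refine (PMF.mean_mono (β₂ h) fun b _ => hb b).trans ?_
      rw [PMF.mean_add, PMF.mean_const]
      linarith [hg h a]
    · have hb : ∀ b, G.stageMean h a b (G.histValue σ₁
          (G.testAndPunish₂ β₁ β₂ g₁ g₂ ε deadline τ₂) G.r₁) ≤
          ((G.trans s a b).mean fun t _ => G.c₁ t) + ε' := by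
        intro b
        rw [← PMF.mean_const (G.trans s a b) ε', ← PMF.mean_add]
        refine PMF.mean_mono _ fun t ht => histValue_le_c₁_of_failure hτ ?_ σ₁
        exact sinceFailure_snoc_of_not_passes hh ht fun hp => ha ⟨hp.2.1, hp.2.2.2.1⟩
      refine (PMF.mean_mono (β₂ h) fun b _ => hb b).trans ?_
      rw [PMF.mean_add, PMF.mean_const]
      linarith [G.mean_c₁_le_jump₁ (β₂ h) a, hv h]
  induction m with
  | zero =>
    intro s h hh hm hs
    -- Beyond the deadline no test can be passed, so nothing about the continuation is needed.
    refine hone h hh hs fun a b t ht hp => absurd hp.1 ?_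
    omega
  | succ m ih =>
    intro s h hh hm hs
    refine hone h hh hs fun a b t ht hp => ih _ (sinceFailure_snoc_of_passes hh ht hp) ?_ ?_
    · simp only [Hist.stage, Hist.root]; omega
    · exact hp.2.2.2.1

/-- Against testing and punishment Player Two cannot gain much from a deviation, whatever his
remaining tolerance is. -/
theorem histValue_deviation₂_le {v₂ : ∀ ⦃s : S⦄, G.Hist s → ℝ}
    (hτ : ∀ s (σ₂ : G.Strategy₂), G.V₂ s τ₁ σ₂ ≤ G.c₂ s + ε')
    (hv : ∀ ⦃s⦄ (h : G.Hist s), G.jump₂ s (β₁ h) - ε ≤ v₂ h)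
    (hg : ∀ ⦃s⦄ (h : G.Hist s) b, g₂ h b = ((β₁ h).mean fun a _ => G.stageMean h a b v₂) - v₂ h)
    (σ₂ : G.Strategy₂) (m : ℕ) :
    ∀ {s : S} (h : G.Hist s), G.sinceFailure β₁ β₂ g₁ g₂ ε deadline h = none →
      deadline h.root + 1 ≤ h.stage + m → G.score₂ g₂ h ≤ ε →
      G.histValue (G.testAndPunish₁ β₁ β₂ g₁ g₂ ε deadline τ₁) σ₂ G.r₂ h
        ≤ v₂ h - G.score₂ g₂ h + (2 * ε + ε') := by
  have hone : ∀ {s : S} (h : G.Hist s), G.sinceFailure β₁ β₂ g₁ g₂ ε deadline h = none →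
      G.score₂ g₂ h ≤ ε →
      (∀ a b t (ht : t ∈ (G.trans s a b).support), G.Passes β₁ β₂ g₁ g₂ ε deadline h a b →
        G.histValue (G.testAndPunish₁ β₁ β₂ g₁ g₂ ε deadline τ₁) σ₂ G.r₂ (h.snoc a b ht)
          ≤ v₂ (h.snoc a b ht) - G.score₂ g₂ (h.snoc a b ht) + (2 * ε + ε')) →
      G.histValue (G.testAndPunish₁ β₁ β₂ g₁ g₂ ε deadline τ₁) σ₂ G.r₂ h
        ≤ v₂ h - G.score₂ g₂ h + (2 * ε + ε') := by
    intro s h hh hs hnext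
    -- The moves are independent, so the averages can be exchanged and Player Two's move fixed
    -- first.
    rw [histValue_eq, PMF.mean_comm]
    have hβ : G.testAndPunish₁ β₁ β₂ g₁ g₂ ε deadline τ₁ h = β₁ h := by
      simp only [testAndPunish₁, hh]
    rw [hβ]
    refine (PMF.mean_mono _ fun b _ => ?_).trans (PMF.mean_const (σ₂ h) _).le
    by_cases hb : b ∈ (β₂ h).support ∧ G.score₂ g₂ h + g₂ h b ≤ ε
    · have ha : ∀ a, G.stageMean h a b (G.histValue
          (G.testAndPunish₁ β₁ β₂ g₁ g₂ ε deadline τ₁) σ₂ G.r₂) ≤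
          G.stageMean h a b v₂ + (2 * ε + ε' - (G.score₂ g₂ h + g₂ h b)) := by
        intro a
        unfold stageMean
        rw [← PMF.mean_const (G.trans s a b) (2 * ε + ε' - _), ← PMF.mean_add]
        refine PMF.mean_mono _ fun t ht => ?_
        by_cases hp : G.Passes β₁ β₂ g₁ g₂ ε deadline h a b
        · have := hnext a b t ht hp
          simp only [score₂] at this
          linarith
        · have h₁ := histValue_le_c₂_of_failure hτ (sinceFailure_snoc_of_not_passes hh ht hp) σ₂
          have h₂ := G.c₂_le_jump₂ t (β₁ (h.snoc a b ht))
          have h₃ := hv (h.snoc a b ht)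
          linarith [hb.2]
      refine (PMF.mean_mono (β₁ h) fun a _ => ha a).trans ?_
      rw [PMF.mean_add, PMF.mean_const]
      linarith [hg h b]
    · have ha : ∀ a, G.stageMean h a b (G.histValue
          (G.testAndPunish₁ β₁ β₂ g₁ g₂ ε deadline τ₁) σ₂ G.r₂) ≤
          ((G.trans s a b).mean fun t _ => G.c₂ t) + ε' := by
        intro a
        rw [← PMF.mean_const (G.trans s a b) ε', ← PMF.mean_add]
        refine PMF.mean_mono _ fun t ht => histValue_le_c₂_of_failure hτ ?_ σ₂
        exact sinceFailure_snoc_of_not_passes hh ht fun hp => hb ⟨hp.2.2.1, hp.2.2.2.2⟩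
      refine (PMF.mean_mono (β₁ h) fun a _ => ha a).trans ?_
      rw [PMF.mean_add, PMF.mean_const]
      linarith [G.mean_c₂_le_jump₂ (β₁ h) b, hv h]
  induction m with
  | zero =>
    intro s h hh hm hs
    refine hone h hh hs fun a b t ht hp => absurd hp.1 ?_
    omega
  | succ m ih =>
    intro s h hh hm hs
    refine hone h hh hs fun a b t ht hp => ih _ (sinceFailure_snoc_of_passes hh ht hp) ?_ ?_
    · simp only [Hist.stage, Hist.root]; omega
    · exact hp.2.2.2.2

end Deviation

/-! ### Lower bound when both players comply -/

section Compliance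

/-- If both players comply, the failure of a test is unlikely and the expected payoff is close to
the harmonic function `v`. The term `Φ m h` controls the variance of the scores during `m` stages
and the probability that play is not absorbed by then. -/
theorem le_histValue_testAndPunish (hε : 0 < ε) {r : S → ℝ} {lo : ℝ}
    {v : ∀ ⦃s : S⦄, G.Hist s → ℝ} {Φ : ℕ → ∀ ⦃s : S⦄, G.Hist s → ℝ}
    (hlo : ∀ s, lo ≤ G.payoff r s) (hv_le : ∀ ⦃s⦄ (h : G.Hist s), v h ≤ lo + 1)
    (hv_abs : ∀ ⦃s⦄ (h : G.Hist s), G.IsAbsorbing s → v h = r s)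
    (hv : ∀ ⦃s⦄ (h : G.Hist s),
      v h = (β₁ h).mean fun a _ => (β₂ h).mean fun b _ => G.stageMean h a b v)
    (hg₁ : ∀ ⦃s⦄ (h : G.Hist s), ((β₁ h).mean fun a _ => g₁ h a) = 0)
    (hg₂ : ∀ ⦃s⦄ (h : G.Hist s), ((β₂ h).mean fun b _ => g₂ h b) = 0)
    (hΦ : ∀ m ⦃s⦄ (h : G.Hist s), 0 ≤ Φ m h)
    (hΦ₀ : ∀ ⦃s⦄ (h : G.Hist s), G.transient s ≤ Φ 0 h)
    (hΦs : ∀ m ⦃s⦄ (h : G.Hist s),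
      ((β₁ h).mean fun a _ => g₁ h a ^ 2) / ε ^ 2 + ((β₂ h).mean fun b _ => g₂ h b ^ 2) / ε ^ 2
        + ((β₁ h).mean fun a _ => (β₂ h).mean fun b _ => G.stageMean h a b (Φ m)) ≤ Φ (m + 1) h)
    (m : ℕ) :
    ∀ {s : S} (h : G.Hist s), G.sinceFailure β₁ β₂ g₁ g₂ ε deadline h = none →
      h.stage + m = deadline h.root + 1 →
      v h - (G.score₁ g₁ h ^ 2 + G.score₂ g₂ h ^ 2) / ε ^ 2 - Φ m h ≤
        G.histValue (G.testAndPunish₁ β₁ β₂ g₁ g₂ ε deadline τ₁)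
          (G.testAndPunish₂ β₁ β₂ g₁ g₂ ε deadline τ₂) r h := by
  have hε2 : 0 < ε ^ 2 := by positivity
  induction m with
  | zero =>
    intro s h hh hm
    have hsq : 0 ≤ (G.score₁ g₁ h ^ 2 + G.score₂ g₂ h ^ 2) / ε ^ 2 := by positivity
    -- After the deadline either play is absorbed and the payoff equals `v`, or `Φ 0 h ≥ 1`, which
    -- covers the whole range between `lo` and `v`.
    by_cases hs : G.IsAbsorbing s
    · rw [histValue_of_isAbsorbing _ _ _ hs, ← hv_abs h hs]
      linarith [hΦ 0 h]
    · have h₁ := hΦ₀ h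
      rw [transient, if_neg hs] at h₁
      linarith [hv_le h, le_histValue (G.testAndPunish₁ β₁ β₂ g₁ g₂ ε deadline τ₁)
          (G.testAndPunish₂ β₁ β₂ g₁ g₂ ε deadline τ₂) hlo h]
  | succ m ih =>
    intro s h hh hm
    rw [histValue_eq]
    have hβ₁ : G.testAndPunish₁ β₁ β₂ g₁ g₂ ε deadline τ₁ h = β₁ h := by
      simp only [testAndPunish₁, hh]
    have hβ₂ : G.testAndPunish₂ β₁ β₂ g₁ g₂ ε deadline τ₂ h = β₂ h := by
      simp only [testAndPunish₂, hh]
    rw [hβ₁, hβ₂]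
    have hnext : ∀ a ∈ (β₁ h).support, ∀ b ∈ (β₂ h).support,
        (G.stageMean h a b v - G.stageMean h a b (Φ m))
          - ((G.score₁ g₁ h + g₁ h a) ^ 2 + (G.score₂ g₂ h + g₂ h b) ^ 2) / ε ^ 2 ≤
        G.stageMean h a b (G.histValue (G.testAndPunish₁ β₁ β₂ g₁ g₂ ε deadline τ₁)
          (G.testAndPunish₂ β₁ β₂ g₁ g₂ ε deadline τ₂) r) := by
      intro a ha b hb
      unfold stageMean
      rw [← PMF.mean_sub, ← PMF.mean_const (G.trans s a b) (_ / ε ^ 2), ← PMF.mean_sub]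
      refine PMF.mean_mono _ fun t ht => ?_
      by_cases hp : G.Passes β₁ β₂ g₁ g₂ ε deadline h a b
      · have := ih (h.snoc a b ht) (sinceFailure_snoc_of_passes hh ht hp)
          (by simp only [Hist.stage, Hist.root]; omega)
        simp only [score₁, score₂] at this
        linarith
      -- The stage is within the deadline and the moves are in the supports, so only a score can
      -- cause the failure. Its square over `ε ^ 2` is then at least `1`, the largest possible loss.
      · have hs : ε < G.score₁ g₁ h + g₁ h a ∨ ε < G.score₂ g₂ h + g₂ h b := by
          by_contra! hcon
          exact hp ⟨by omega, ha, hb, hcon.1, hcon.2⟩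
        have h₁ : 1 ≤ ((G.score₁ g₁ h + g₁ h a) ^ 2 + (G.score₂ g₂ h + g₂ h b) ^ 2) / ε ^ 2 := by
          rw [le_div_iff₀ hε2, one_mul]
          rcases hs with hs | hs
          · nlinarith [sq_nonneg (G.score₂ g₂ h + g₂ h b)]
          · nlinarith [sq_nonneg (G.score₁ g₁ h + g₁ h a)]
        linarith [hv_le (h.snoc a b ht), hΦ m (h.snoc a b ht),
          le_histValue (G.testAndPunish₁ β₁ β₂ g₁ g₂ ε deadline τ₁)
          (G.testAndPunish₂ β₁ β₂ g₁ g₂ ε deadline τ₂) hlo (h.snoc a b ht)]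
    refine le_trans ?_ (PMF.mean_mono _ fun a ha => PMF.mean_mono _ fun b hb => hnext a ha b hb)
    simp only [PMF.mean_sub]
    rw [← hv h]
    -- The increments have mean zero, so the linear terms vanish and the mean squares grow only by
    -- the variances.
    have hsq : ((β₁ h).mean fun a _ => (β₂ h).mean fun b _ =>
        ((G.score₁ g₁ h + g₁ h a) ^ 2 + (G.score₂ g₂ h + g₂ h b) ^ 2) / ε ^ 2) =
        (G.score₁ g₁ h ^ 2 + G.score₂ g₂ h ^ 2) / ε ^ 2 +
        (((β₁ h).mean fun a _ => g₁ h a ^ 2) / ε ^ 2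
          + ((β₂ h).mean fun b _ => g₂ h b ^ 2) / ε ^ 2) := by
      have he : ∀ a b, ((G.score₁ g₁ h + g₁ h a) ^ 2 + (G.score₂ g₂ h + g₂ h b) ^ 2) / ε ^ 2 =
          ((((G.score₁ g₁ h ^ 2 + G.score₂ g₂ h ^ 2) / ε ^ 2
            + (2 * G.score₁ g₁ h / ε ^ 2) * g₁ h a) + (1 / ε ^ 2) * g₁ h a ^ 2)
            + (2 * G.score₂ g₂ h / ε ^ 2) * g₂ h b) + (1 / ε ^ 2) * g₂ h b ^ 2 := by
        intro a b; ring
      simp only [he, PMF.mean_add, PMF.mean_const, PMF.mean_const_mul, hg₁, hg₂]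
      ring
    rw [hsq]
    linarith [hΦs m h]

end Compliance

end RecursiveGame

/-! ### Total variation of a harmonic function along a finite absorbed chain -/

section FiniteChain

variable {C : Type*} [MeasurableSpace C] [DiscreteMeasurableSpace C] [Finite C] {K : C → PMF C}

theorem exists_abs_le_of_finite (f : C → ℝ) : ∃ M, ∀ c, |f c| ≤ M := by
  obtain ⟨M, hM⟩ := (Set.finite_range fun c => |f c|).bddAbove
  exact ⟨M, fun c => hM ⟨c, rfl⟩⟩

theorem chainOp_mono_of_finite {f g : C → ℝ} (h : ∀ c, f c ≤ g c) (c : C) :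
    chainOp K f c ≤ chainOp K g c := by
  obtain ⟨M, hM⟩ := exists_abs_le_of_finite f
  obtain ⟨N, hN⟩ := exists_abs_le_of_finite g
  exact chainOp_mono K hM hN h c

theorem chainOp_add_of_finite (f g : C → ℝ) (c : C) :
    chainOp K (fun d => f d + g d) c = chainOp K f c + chainOp K g c := by
  obtain ⟨M, hM⟩ := exists_abs_le_of_finite f
  obtain ⟨N, hN⟩ := exists_abs_le_of_finite g
  exact integral_add (integrable_of_discrete _ hM) (integrable_of_discrete _ hN)

theorem chainOp_const_mul (a : ℝ) (f : C → ℝ) (c : C) :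
    chainOp K (fun d => a * f d) c = a * chainOp K f c :=
  integral_const_mul a f

theorem chainOp_sum_of_finite {ι : Type*} (s : Finset ι) (f : ι → C → ℝ) (c : C) :
    chainOp K (fun d => ∑ i ∈ s, f i d) c = ∑ i ∈ s, chainOp K (f i) c := by
  refine integral_finsetSum s fun i _ => ?_
  obtain ⟨M, hM⟩ := exists_abs_le_of_finite (f i)
  exact integrable_of_discrete _ hM

/-- If the mean of a function is at least its upper bound `m`, then the function equals `m` on the
support. -/
theorem eq_of_le_chainOp {f : C → ℝ} {m : ℝ} (hf : ∀ c, f c ≤ m) {c d : C}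
    (hc : m ≤ chainOp K f c) (hd : d ∈ (K c).support) : f d = m := by
  have : Fintype C := Fintype.ofFinite C
  refine le_antisymm (hf d) (not_lt.1 fun hlt => hc.not_gt ?_)
  unfold chainOp
  rw [PMF.integral_eq_sum, ← one_mul m, ← (K c).sum_toReal, Finset.sum_mul]
  refine Finset.sum_lt_sum (fun e _ => ?_) ⟨d, Finset.mem_univ d, ?_⟩
  · exact mul_le_mul_of_nonneg_left (hf e) ENNReal.toReal_nonneg
  · exact mul_lt_mul_of_pos_left hlt
      (ENNReal.toReal_pos ((K c).mem_support_iff d |>.1 hd) ((K c).apply_ne_top d))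

/-- The maximum principle for a chain that is absorbed with probability one: `u n` is the
probability that it has not been absorbed after `n` steps. -/
theorem le_of_le_chainOp {u : C → ℝ}
    (hlim : ∀ c, Filter.Tendsto (fun n => (chainOp K)^[n] u c) Filter.atTop (nhds 0))
    {f : C → ℝ} {M : ℝ} (hf : ∀ c, f c ≤ M ∨ (u c = 1 ∧ f c ≤ chainOp K f c)) (c : C) :
    f c ≤ M := by
  have : Nonempty C := ⟨c⟩
  obtain ⟨c₀, hc₀⟩ := Finite.exists_max f
  refine (hc₀ c).trans (not_lt.1 fun hlt => ?_)
  -- If the maximum exceeded `M`, the chain could move from maximizers only to maximizers, where `u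
  -- = 1`; it would never be absorbed.
  have h : ∀ n c, f c = f c₀ → (chainOp K)^[n] u c = 1 := by
    intro n
    induction n with
    | zero =>
      intro c hc
      rcases hf c with h | h
      · linarith
      · exact h.1
    | succ n ih =>
      intro c hc
      rw [Function.iterate_succ_apply', ← chainOp_const K 1 c]
      refine chainOp_congr fun d hd => ih d ?_
      rcases hf c with h | h
      · linarith
      · exact eq_of_le_chainOp hc₀ (hc ▸ h.2) hd
  have h1 := hlim c₀
  simp only [h _ c₀ rfl] at h1
  exact one_ne_zero (tendsto_nhds_unique tendsto_const_nhds h1)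

/-- The expected sum of `D` over the first `m` stages of the chain. -/
noncomputable def expectedSum (K : C → PMF C) (D : C → ℝ) : ℕ → C → ℝ
  | 0, _ => 0
  | m + 1, c => D c + chainOp K (expectedSum K D m) c

theorem expectedSum_nonneg {D : C → ℝ} (hD : ∀ c, 0 ≤ D c) (m : ℕ) :
    ∀ c, 0 ≤ expectedSum K D m c := by
  induction m with
  | zero => exact fun _ => le_rfl
  | succ m ih =>
    intro c
    have := chainOp_mono_of_finite (K := K) ih c
    rw [chainOp_const] at this
    exact add_nonneg (hD c) this

/-- Unfolded once, this gives `g ≤ D + chainOp K g` for the expected sum `g`, so that `g` is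
subharmonic wherever `D` vanishes. -/
theorem expectedSum_le_succ {D : C → ℝ} (hD : ∀ c, 0 ≤ D c) (m : ℕ) :
    ∀ c, expectedSum K D m c ≤ expectedSum K D (m + 1) c := by
  induction m with
  | zero => exact expectedSum_nonneg hD 1
  | succ m ih => exact fun c => add_le_add_right (chainOp_mono_of_finite ih c) _

-- Groups the sum by the point visited; the second factor is the expected number of visits to `z`.
open Classical in
theorem expectedSum_eq_sum [Fintype C] (D : C → ℝ) (m : ℕ) :
    ∀ c, expectedSum K D m c
      = ∑ z, D z * expectedSum K (fun c => if c = z then 1 else 0) m c := by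
  induction m with
  | zero => intro c; simp [expectedSum]
  | succ m ih =>
    intro c
    simp only [expectedSum]
    rw [funext ih, chainOp_sum_of_finite]
    simp only [chainOp_const_mul, mul_add, Finset.sum_add_distrib]
    simp

/-- If `D z` is at most the expected value of every upper bound of `|ρ - ρ z|` at the next stage,
where `ρ` is a harmonic function with values in an interval of length `L`, then the expected sum of
`D` over an arbitrary number of stages is at most `L` times the number of points. -/
theorem expectedSum_le {u : C → ℝ} (hu : ∀ c, u c = 0 ∨ u c = 1)
    (hlim : ∀ c, Filter.Tendsto (fun n => (chainOp K)^[n] u c) Filter.atTop (nhds 0))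
    {ρ D : C → ℝ} {L : ℝ} (hL : 0 ≤ L) (hρ : ∀ c, ρ c = chainOp K ρ c)
    (hρL : ∀ c d, |ρ c - ρ d| ≤ L)
    (hu0 : ∀ c, u c = 0 → ∀ d ∈ (K c).support, u d = 0 ∧ ρ d = ρ c)
    (hD : ∀ z (H : C → ℝ), (∀ c, |ρ c - ρ z| ≤ H c) → D z ≤ chainOp K H z)
    (m : ℕ) (c : C) (hDn : ∀ c, 0 ≤ D c) : expectedSum K D m c ≤ Nat.card C * L := by
  classical
  have : Fintype C := Fintype.ofFinite C
  -- Let `g c` be the expected number of visits to `z` from `c`. Heuristically `g c / g z` is the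
  -- chance of reaching `z`, where a harmonic `ρ` has the value `ρ z`; hence `|ρ c - ρ z| ≤ L (1 - g
  -- c / g z)`. Averaging over the stage after `z` and using `g z ≤ 1 + chainOp K g z` yields `D z *
  -- g z ≤ L`.
  have key : ∀ z, D z * expectedSum K (fun c => if c = z then 1 else 0) m c ≤ L := by
    intro z
    set I : C → ℝ := fun c => if c = z then 1 else 0 with hI
    have hI0 : ∀ c, 0 ≤ I c := by intro c; simp only [hI]; split_ifs <;> norm_num
    set g : C → ℝ := expectedSum K I m with hg
    rcases hu z with hz | hz
    · have h := hD z (fun c => |ρ c - ρ z|) fun _ => le_rfl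
      have h' : chainOp K (fun c => |ρ c - ρ z|) z = 0 := by
        rw [← chainOp_const K 0 z]
        refine chainOp_congr fun d hd => ?_
        rw [(hu0 z hz d hd).2, sub_self, abs_zero]
      have : D z = 0 := le_antisymm (h.trans h'.le) (hDn z)
      rw [this, zero_mul]
      exact hL
    · have hsub : ∀ c, g c ≤ I c + chainOp K g c := expectedSum_le_succ hI0 m
      have hsub' : ∀ c, c ≠ z → g c ≤ chainOp K g c := by
        intro c hc
        have := hsub c
        simp only [hI, if_neg hc, zero_add] at this
        exact this
      have hg0 : ∀ c, 0 ≤ g c := expectedSum_nonneg hI0 m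
      have habs : ∀ m c, u c = 0 → expectedSum K I m c = 0 := by
        intro m
        induction m with
        | zero => exact fun _ _ => rfl
        | succ m ih =>
          intro c hc
          have hcz : c ≠ z := by rintro rfl; rw [hz] at hc; norm_num at hc
          simp only [expectedSum, hI, if_neg hcz, zero_add]
          refine (chainOp_congr (g := fun _ => 0) fun d hd => ?_).trans (chainOp_const K 0 c)
          exact ih d (hu0 c hc d hd).1
      have hmax : ∀ c, g c ≤ g z := by
        refine le_of_le_chainOp hlim fun c => ?_
        by_cases hcz : c = z
        · exact Or.inl (hcz ▸ le_rfl)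
        rcases hu c with hc | hc
        · exact Or.inl ((habs m c hc).le.trans (hg0 z))
        · exact Or.inr ⟨hc, hsub' c hcz⟩
      -- The function on the left is subharmonic at transient points other than `z`. Where `u = 0`
      -- also `g = 0`, and there the bound `L` on the oscillation of `ρ` suffices. The signs `σ =
      -- ±1` give the absolute value in `hdiff`.
      have hbound : ∀ σ : ℝ, |σ| ≤ 1 → ∀ c, (σ * g z) * (ρ c) + L * g c ≤
          (σ * g z) * ρ z + L * g z := by
        intro σ hσ
        refine le_of_le_chainOp hlim fun c => ?_
        by_cases hcz : c = z
        · exact Or.inl (by rw [hcz])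
        rcases hu c with hc | hc
        · left
          have h0 : g c = 0 := habs m c hc
          have h1 : σ * (ρ c - ρ z) ≤ L := by
            refine (le_abs_self _).trans ?_
            rw [abs_mul]
            exact (mul_le_mul hσ (hρL c z) (abs_nonneg _) zero_le_one).trans (one_mul L).le
          rw [h0]
          nlinarith [mul_le_mul_of_nonneg_left h1 (hg0 z)]
        · right
          refine ⟨hc, ?_⟩
          rw [chainOp_add_of_finite, chainOp_const_mul, chainOp_const_mul, ← hρ]
          exact add_le_add_right (mul_le_mul_of_nonneg_left (hsub' c hcz) hL) _
      have hdiff : ∀ c, |ρ c - ρ z| * g z ≤ L * (g z - g c) := by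
        intro c
        rw [← abs_of_nonneg (hg0 z), ← abs_mul, abs_of_nonneg (hg0 z)]
        refine abs_le.2 ⟨?_, ?_⟩
        · linarith [hbound (-1) (by simp) c]
        · linarith [hbound 1 (by simp) c]
      refine (mul_le_mul_of_nonneg_left (hmax c) (hDn z)).trans ?_
      rcases (hg0 z).eq_or_lt with h0 | hpos
      · rw [← h0, mul_zero]; exact hL
      -- This majorant of `|ρ - ρ z|` is affine in `g`, so its mean involves only `chainOp K g z`,
      -- which is at least `g z - 1`.
      · have h := hD z (fun c => L + (-(L / g z)) * g c) fun c => by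
          have h := hdiff c
          rw [← le_div_iff₀ hpos] at h
          refine h.trans (le_of_eq ?_)
          field_simp
          ring
        rw [chainOp_add_of_finite, chainOp_const, chainOp_const_mul] at h
        have h1 := hsub z
        simp only [hI, if_true] at h1
        have h2 := mul_le_mul_of_nonneg_right h hpos.le
        have h3 : (L + -(L / g z) * chainOp K g z) * g z = L * (g z - chainOp K g z) := by
          field_simp
          ring
        rw [h3] at h2
        nlinarith
  rw [expectedSum_eq_sum]
  refine (Finset.sum_le_sum fun z _ => key z).trans ?_
  rw [Finset.sum_const, Finset.card_univ, nsmul_eq_mul, Nat.card_eq_fintype_card]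

end FiniteChain

namespace RecursiveGame

universe u v w

variable {S : Type u} {A : S → Type v} {B : S → Type w} {G : RecursiveGame A B}

/-! ### Equilibria from stationary strategies on normal situations -/

section Situations

variable {P : ∀ s, Setoid (G.Hist s)} (hP : G.Normal P)
  (x : ∀ c : G.Situation P, PMF (A c.state)) (y : ∀ c : G.Situation P, PMF (B c.state))

theorem Normal.respects_step : G.Respects (hP.step x y) Situation.state :=
  fun _ hh _ hk => state_eq_of_mem_support_stage (fun _ _ _ _ => rfl) hh hk

variable [Fintype S] [∀ s, Fintype (A s)] [∀ s, Fintype (B s)]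

theorem Normal.chainOp_step {f : G.Situation P → ℝ} {C : ℝ} (hf : ∀ c, |f c| ≤ C)
    (c : G.Situation P) :
    chainOp (hP.step x y) f c = (x c).mean fun a _ => (y c).mean fun b _ =>
      (G.trans c.state a b).mean fun _ ht => f (hP.next c a b ht) :=
  integral_stage _ _ _ _ hf

/-- Normality makes the successive situations of a play a Markov chain. Consequently payoffs and
absorption depend on a history only through its situation. -/
theorem Normal.chainOp_playStep_eq {C : ℝ} {g : G.AnyHist → ℝ} {g' : G.Situation P → ℝ}
    (hg : ∀ k, |g k| ≤ C) (hg' : ∀ c, |g' c| ≤ C) (hgg : ∀ k, g k = g' (G.situation k.hist))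
    (k : G.AnyHist) :
    chainOp (G.playStep (G.onSituations₁ x) (G.onSituations₂ y)) g k
      = chainOp (hP.step x y) g' (G.situation k.hist) := by
  rw [chainOp_playStep G _ _ hg, hP.chainOp_step x y hg']
  simp only [hgg]
  rfl

theorem Normal.histValue_eq_chainValue (r : S → ℝ) {s : S} (h : G.Hist s) :
    G.histValue (G.onSituations₁ x) (G.onSituations₂ y) r h
      = G.chainValue (hP.step x y) Situation.state r (G.situation h) :=
  (G.respects_playStep _ _).chainValue_transfer (hP.respects_step x y)
    (φ := fun k => G.situation k.hist) (R := fun _ => True) r (fun _ _ => rfl)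
    (fun _ k _ _ _ hg hg' hgg =>
      hP.chainOp_playStep_eq x y hg hg' (fun k => hgg k trivial) k) (a := ⟨s, h⟩) trivial

theorem Normal.transient_playStep_eq (n : ℕ) {s : S} (h : G.Hist s) :
    (chainOp (G.playStep (G.onSituations₁ x) (G.onSituations₂ y)))^[n]
        (fun k => G.transient k.state) ⟨s, h⟩
      = (chainOp (hP.step x y))^[n] (fun c => G.transient c.state) (G.situation h) := by
  have := chainOp_iterate_transfer (K := G.playStep (G.onSituations₁ x) (G.onSituations₂ y))
    (L := hP.step x y) (φ := fun k => G.situation k.hist) (R := fun _ => True) (C := 1)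
    (fun k _ _ _ hg hg' hgg => hP.chainOp_playStep_eq x y hg hg' (fun k => hgg k trivial) k)
    (f := fun k => G.transient k.state) (f' := fun c => G.transient c.state)
    (fun k => G.abs_transient_le k.state) (fun c => G.abs_transient_le c.state) (fun _ _ => rfl) n
  exact this ⟨s, h⟩ trivial

theorem Normal.w₁_eq_mean (c : G.Situation P) (a : A c.state) :
    hP.w₁ x y c a = (y c).mean fun b _ => (G.trans c.state a b).mean fun _ ht =>
      hP.value₁ x y (hP.next c a b ht) :=
  (PMF.mean_eq_sum (y c) fun b => hP.expectNext (hP.value₁ x y) c a b).symm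

theorem Normal.w₂_eq_mean (c : G.Situation P) (b : B c.state) :
    hP.w₂ x y c b = (x c).mean fun a _ => (G.trans c.state a b).mean fun _ ht =>
      hP.value₂ x y (hP.next c a b ht) :=
  (PMF.mean_eq_sum (x c) fun a => hP.expectNext (hP.value₂ x y) c a b).symm

theorem Normal.w₁_situation {s : S} (k : G.Hist s) (a : A s) :
    hP.w₁ x y (G.situation k) a = (y (G.situation k)).mean fun b _ =>
      G.stageMean k a b fun _ k => hP.value₁ x y (G.situation k) :=
  hP.w₁_eq_mean x y (G.situation k) a

theorem Normal.w₂_situation {s : S} (k : G.Hist s) (b : B s) :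
    hP.w₂ x y (G.situation k) b = (x (G.situation k)).mean fun a _ =>
      G.stageMean k a b fun _ k => hP.value₂ x y (G.situation k) :=
  hP.w₂_eq_mean x y (G.situation k) b

variable {x y}

section Values

variable [Finite (G.Situation P)]

theorem Normal.chainOp_step_of_finite (f : G.Situation P → ℝ) (c : G.Situation P) :
    chainOp (hP.step x y) f c = (x c).mean fun a _ => (y c).mean fun b _ =>
      (G.trans c.state a b).mean fun _ ht => f (hP.next c a b ht) := by
  obtain ⟨M, hM⟩ := exists_abs_le_of_finite f
  exact hP.chainOp_step x y hM c

variable {hP}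

theorem Normal.AbsorbingPair.tendsto (h : hP.AbsorbingPair x y) (c : G.Situation P) :
    Filter.Tendsto (fun n => (chainOp (hP.step x y))^[n] (fun c => G.transient c.state) c)
      Filter.atTop (nhds 0) :=
  (hP.respects_step x y).tendsto_transient (h c)

theorem Normal.AbsorbingPair.chainValue_le (h : hP.AbsorbingPair x y) {r : S → ℝ} {M : ℝ}
    (hr : ∀ s, G.IsAbsorbing s → r s ≤ M) (c : G.Situation P) :
    G.chainValue (hP.step x y) Situation.state r c ≤ M := by
  refine le_of_le_chainOp h.tendsto (f := G.chainValue (hP.step x y) Situation.state r)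
    (fun c => ?_) c
  by_cases hc : G.IsAbsorbing c.state
  · left
    rw [(hP.respects_step x y).chainValue_of_isAbsorbing r hc]
    exact hr _ hc
  · exact Or.inr ⟨if_neg hc, ((hP.respects_step x y).chainValue_eq_op r c).le⟩

/-- A play that is never absorbed pays zero, which may be less than `M`; almost sure absorption
enters through the maximum principle. For Player Two the bound `ω` shortens the payoff interval to
length `1 - ω`. -/
theorem Normal.AbsorbingPair.le_chainValue (h : hP.AbsorbingPair x y) {r : S → ℝ} {M : ℝ}
    (hr : ∀ s, G.IsAbsorbing s → M ≤ r s) (c : G.Situation P) :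
    M ≤ G.chainValue (hP.step x y) Situation.state r c := by
  have := le_of_le_chainOp h.tendsto (M := -M)
    (f := fun c => (-1) * G.chainValue (hP.step x y) Situation.state r c) (fun c => ?_) c
  · linarith
  by_cases hc : G.IsAbsorbing c.state
  · left
    rw [(hP.respects_step x y).chainValue_of_isAbsorbing r hc]
    linarith [hr _ hc]
  · right
    rw [chainOp_const_mul, ← (hP.respects_step x y).chainValue_eq_op r c]
    exact ⟨if_neg hc, le_rfl⟩

theorem Normal.AbsorbingPair.expectedSum_le (h : hP.AbsorbingPair x y) {r : S → ℝ} {lo hi : ℝ}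
    (hlh : lo ≤ hi) (hlo : ∀ s, G.IsAbsorbing s → lo ≤ r s)
    (hhi : ∀ s, G.IsAbsorbing s → r s ≤ hi) {D : G.Situation P → ℝ} (hD0 : ∀ c, 0 ≤ D c)
    (hD : ∀ z (H : G.Situation P → ℝ),
      (∀ c, |G.chainValue (hP.step x y) Situation.state r c
        - G.chainValue (hP.step x y) Situation.state r z| ≤ H c) → D z ≤ chainOp (hP.step x y) H z)
    (m : ℕ) (c : G.Situation P) :
    expectedSum (hP.step x y) D m c ≤ Nat.card (G.Situation P) * (hi - lo) := by
  have hK := hP.respects_step x y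
  have habs : ∀ c : G.Situation P, G.transient c.state = 0 → G.IsAbsorbing c.state := by
    intro c hc
    by_contra hn
    rw [transient, if_neg hn] at hc
    exact one_ne_zero hc
  refine _root_.expectedSum_le (u := fun c => G.transient c.state) (fun c => ?_) h.tendsto
    (sub_nonneg.2 hlh) (hK.chainValue_eq_op r) (fun c d => ?_) (fun c hc d hd => ?_) hD m c hD0
  · unfold transient; split_ifs <;> simp
  · have h₁ := h.chainValue_le hhi c
    have h₂ := h.chainValue_le hhi d
    have h₃ := h.le_chainValue hlo c
    have h₄ := h.le_chainValue hlo d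
    exact abs_le.2 ⟨by linarith, by linarith⟩
  · have hs := hK c (habs c hc) d hd
    refine ⟨by rw [hs, hc], ?_⟩
    rw [hK.chainValue_of_isAbsorbing r (habs c hc),
      hK.chainValue_of_isAbsorbing r (hs ▸ habs c hc), hs]

end Values

/-- Trades one factor of the variance for `δ`, leaving the mean absolute increment that
`expectedSum_le` controls. -/
theorem _root_.PMF.mean_sq_le {α : Type*} [Fintype α] (p : PMF α) {f : α → ℝ} {δ : ℝ}
    (hf : ∀ a ∈ p.support, |f a| ≤ δ) :
    (p.mean fun a _ => f a ^ 2) ≤ δ * p.mean fun a _ => |f a| := by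
  rw [← PMF.mean_const_mul]
  refine p.mean_mono fun a ha => ?_
  rw [← sq_abs, sq]
  exact mul_le_mul_of_nonneg_right (hf a ha) (abs_nonneg _)

theorem _root_.PMF.mean_nonneg {α : Type*} [Fintype α] (p : PMF α) {f : ∀ a, a ∈ p.support → ℝ}
    (hf : ∀ a ha, 0 ≤ f a ha) : 0 ≤ p.mean f :=
  (p.mean_const 0).symm.le.trans (p.mean_mono hf)

variable [∀ s, Nonempty (A s)] [∀ s, Nonempty (B s)]

variable {hP} in
/-- Testing and punishment for stationary strategies on normal situations. -/
theorem Normal.AbsorbingPair.generatesEquilibrium [Finite (G.Situation P)]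
    (h : hP.AbsorbingPair x y) {ω : ℝ} (hω₀ : 0 < ω) (hω₁ : ω < 1)
    (hr₁ : ∀ s, G.IsAbsorbing s → G.r₁ s ∈ Set.Icc (-1 / 2 : ℝ) (1 / 2))
    (hr₂ : ∀ s, G.IsAbsorbing s → G.r₂ s ∈ Set.Icc ω 1) {ε δ : ℝ} (hε : 0 < ε)
    (hδ : δ ≤ ε ^ 3 / (Nat.card (G.Situation P) : ℝ))
    (hj₁ : ∀ c, hP.value₁ x y c ≥ G.jump₁ c.state (y c) - ε)
    (hj₂ : ∀ c, hP.value₂ x y c ≥ G.jump₂ c.state (x c) - ε)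
    (hw₁ : ∀ c, ∀ a ∈ (x c).support, |hP.w₁ x y c a - hP.value₁ x y c| ≤ δ)
    (hw₂ : ∀ c, ∀ b ∈ (y c).support, |hP.w₂ x y c b - hP.value₂ x y c| ≤ δ) :
    G.GeneratesEquilibrium (G.onSituations₁ x) (G.onSituations₂ y)
      (fun _ h a => hP.w₁ x y (G.situation h) a - hP.value₁ x y (G.situation h))
      (fun _ h b => hP.w₂ x y (G.situation h) b - hP.value₂ x y (G.situation h))
      ε (4 * ε) := by
  have hK := hP.respects_step x y
  have hε2 : 0 < ε ^ 2 := by positivity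
  have hωε : 0 < ω * ε := mul_pos hω₀ hε
  have hωε' : ω * ε < ε := by nlinarith
  set u : ℕ → G.Situation P → ℝ := fun n =>
    (chainOp (hP.step x y))^[n] (fun c => G.transient c.state) with hu
  -- The shorter payoff interval of Player Two leaves `ω * ε` to spare. It covers `ω * ε / 20` for
  -- late absorption and `ω * ε / 2` for imperfect punishment.
  obtain ⟨N, hN⟩ : ∃ N, ∀ n ≥ N, ∀ c, u n c < ω * ε / 20 := by
    rw [← Filter.eventually_atTop, Filter.eventually_all]
    exact fun c => (h.tendsto c).eventually (gt_mem_nhds (by positivity))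
  have hu0 : ∀ n c, 0 ≤ u n c := by
    intro n
    induction n with
    | zero => exact fun c => G.transient_nonneg _
    | succ n ih =>
      intro c
      have := chainOp_mono_of_finite (K := hP.step x y) ih c
      rw [chainOp_const] at this
      simpa only [hu, Function.iterate_succ_apply'] using this
  obtain ⟨τ₁, hτ₁⟩ := G.exists_punishing₁ (ε := ω * ε / 2) (by positivity)
  obtain ⟨τ₂, hτ₂⟩ := G.exists_punishing₂ (ε := ω * ε / 2) (by positivity)
  set D₁ : G.Situation P → ℝ := fun c =>
    (x c).mean fun a _ => |hP.w₁ x y c a - hP.value₁ x y c| with hD₁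
  set D₂ : G.Situation P → ℝ := fun c =>
    (y c).mean fun b _ => |hP.w₂ x y c b - hP.value₂ x y c| with hD₂
  have hD₁0 : ∀ c, 0 ≤ D₁ c := fun c => PMF.mean_nonneg _ fun _ _ => abs_nonneg _
  have hD₂0 : ∀ c, 0 ≤ D₂ c := fun c => PMF.mean_nonneg _ fun _ _ => abs_nonneg _
  have hF₁ : ∀ m c, expectedSum (hP.step x y) D₁ m c
      ≤ Nat.card (G.Situation P) * (1 / 2 - -1 / 2) := by
    refine h.expectedSum_le (by norm_num) (fun s hs => (hr₁ s hs).1) (fun s hs => (hr₁ s hs).2)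
      hD₁0 fun z H hH => ?_
    rw [hP.chainOp_step_of_finite]
    refine PMF.mean_mono _ fun a _ => ?_
    rw [hP.w₁_eq_mean]
    refine (PMF.abs_mean_sub_le _ _ _).trans (PMF.mean_mono _ fun b _ => ?_)
    exact (PMF.abs_mean_sub_le _ _ _).trans (PMF.mean_mono _ fun t ht => hH _)
  have hF₂ : ∀ m c, expectedSum (hP.step x y) D₂ m c ≤ Nat.card (G.Situation P) * (1 - ω) := by
    refine h.expectedSum_le hω₁.le (fun s hs => (hr₂ s hs).1) (fun s hs => (hr₂ s hs).2)
      hD₂0 fun z H hH => ?_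
    rw [hP.chainOp_step_of_finite, PMF.mean_comm]
    refine PMF.mean_mono _ fun b _ => ?_
    rw [hP.w₂_eq_mean]
    refine (PMF.abs_mean_sub_le _ _ _).trans (PMF.mean_mono _ fun a _ => ?_)
    exact (PMF.abs_mean_sub_le _ _ _).trans (PMF.mean_mono _ fun t ht => hH _)
  have hF₁0 := expectedSum_nonneg (K := hP.step x y) hD₁0
  have hF₂0 := expectedSum_nonneg (K := hP.step x y) hD₂0
  have hharm₁ : ∀ c, hP.value₁ x y c = (x c).mean fun a _ => (y c).mean fun b _ =>
      (G.trans c.state a b).mean fun _ ht => hP.value₁ x y (hP.next c a b ht) := fun c =>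
    (hK.chainValue_eq_op G.r₁ c).trans (hP.chainOp_step_of_finite _ c)
  have hharm₂ : ∀ c, hP.value₂ x y c = (x c).mean fun a _ => (y c).mean fun b _ =>
      (G.trans c.state a b).mean fun _ ht => hP.value₂ x y (hP.next c a b ht) := fun c =>
    (hK.chainValue_eq_op G.r₂ c).trans (hP.chainOp_step_of_finite _ c)
  have hz₁ : ∀ c, ((x c).mean fun a _ => hP.w₁ x y c a - hP.value₁ x y c) = 0 := by
    intro c
    rw [PMF.mean_sub, PMF.mean_const, sub_eq_zero]
    simp only [hP.w₁_eq_mean]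
    exact (hharm₁ c).symm
  have hz₂ : ∀ c, ((y c).mean fun b _ => hP.w₂ x y c b - hP.value₂ x y c) = 0 := by
    intro c
    rw [PMF.mean_sub, PMF.mean_const, sub_eq_zero]
    simp only [hP.w₂_eq_mean]
    rw [PMF.mean_comm]
    exact (hharm₂ c).symm
  set γ₁ : ∀ ⦃s : S⦄, G.Hist s → A s → ℝ :=
    fun _ h a => hP.w₁ x y (G.situation h) a - hP.value₁ x y (G.situation h) with hγ₁
  set γ₂ : ∀ ⦃s : S⦄, G.Hist s → B s → ℝ :=
    fun _ h b => hP.w₂ x y (G.situation h) b - hP.value₂ x y (G.situation h) with hγ₂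
  -- The expected absolute increments of both scores over `m` stages, scaled by `δ / ε ^ 2` to
  -- dominate variances over `ε ^ 2`, plus the probability of not being absorbed after `m` steps.
  set Ψ : ℕ → G.Situation P → ℝ := fun m c => (δ / ε ^ 2 * expectedSum (hP.step x y) D₁ m c
    + δ / ε ^ 2 * expectedSum (hP.step x y) D₂ m c) + u m c with hΨ
  have hδ0 : ∀ c : G.Situation P, 0 ≤ δ := fun c =>
    let ⟨a, ha⟩ := (x c).support_nonempty
    (abs_nonneg _).trans (hw₁ c a ha)
  have hΨ0 : ∀ m c, 0 ≤ Ψ m c := by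
    intro m c
    have := hδ0 c
    have := hF₁0 m c
    have := hF₂0 m c
    have := hu0 m c
    simp only [hΨ]
    positivity
  have hΨs : ∀ m ⦃s⦄ (k : G.Hist s),
      ((G.onSituations₁ x k).mean fun a _ => γ₁ k a ^ 2) / ε ^ 2
        + ((G.onSituations₂ y k).mean fun b _ => γ₂ k b ^ 2) / ε ^ 2
        + ((G.onSituations₁ x k).mean fun a _ => (G.onSituations₂ y k).mean fun b _ =>
          G.stageMean k a b fun _ k => Ψ m (G.situation k)) ≤ Ψ (m + 1) (G.situation k) := by
    intro m s k
    have h₁ := (PMF.mean_sq_le (x (G.situation k)) (hw₁ (G.situation k)))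
    have h₂ := (PMF.mean_sq_le (y (G.situation k)) (hw₂ (G.situation k)))
    have h₃ : ((G.onSituations₁ x k).mean fun a _ => (G.onSituations₂ y k).mean fun b _ =>
          G.stageMean k a b fun _ k => Ψ m (G.situation k))
        = chainOp (hP.step x y) (Ψ m) (G.situation k) :=
      (hP.chainOp_step_of_finite (Ψ m) (G.situation k)).symm
    have h₄ : Ψ (m + 1) (G.situation k) = δ / ε ^ 2 * D₁ (G.situation k)
        + δ / ε ^ 2 * D₂ (G.situation k) + chainOp (hP.step x y) (Ψ m) (G.situation k) := by
      simp only [hΨ, chainOp_add_of_finite, chainOp_const_mul, expectedSum, hu,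
        Function.iterate_succ_apply']
      ring
    rw [h₃, h₄]
    refine add_le_add_left (add_le_add ?_ ?_) _
    · rw [div_mul_eq_mul_div]
      exact div_le_div_of_nonneg_right h₁ hε2.le
    · rw [div_mul_eq_mul_div]
      exact div_le_div_of_nonneg_right h₂ hε2.le
  -- Each test contributes `ε` times the length of the payoff interval, that is `ε` and `(1 - ω) *
  -- ε`.
  have hΨN : ∀ c, Ψ (N + 2) c ≤ 2 * ε - ω * ε + ω * ε / 20 := by
    intro c
    have hne : Nonempty (G.Situation P) := ⟨c⟩
    have hn : 0 < (Nat.card (G.Situation P) : ℝ) := Nat.cast_pos.2 Nat.card_pos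
    have hδε : δ / ε ^ 2 * Nat.card (G.Situation P) ≤ ε := by
      rw [le_div_iff₀ hn] at hδ
      rw [div_mul_eq_mul_div, div_le_iff₀ hε2]
      exact hδ.trans (by ring_nf; exact le_rfl)
    have hq : 0 ≤ δ / ε ^ 2 := div_nonneg (hδ0 c) hε2.le
    have h₁ := mul_le_mul_of_nonneg_left (hF₁ (N + 2) c) hq
    have h₂ := mul_le_mul_of_nonneg_left (hF₂ (N + 2) c) hq
    have h₃ := hN (N + 2) (by omega) c
    have h₄ := mul_le_mul_of_nonneg_right hδε (sub_nonneg.2 hω₁.le)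
    simp only [hΨ]
    linarith
  have hg₁ : ∀ ⦃s⦄ (k : G.Hist s) a, γ₁ k a = ((G.onSituations₂ y k).mean fun b _ =>
      G.stageMean k a b fun _ k => hP.value₁ x y (G.situation k))
        - hP.value₁ x y (G.situation k) := by
    intro s k a
    exact congrArg (· - hP.value₁ x y (G.situation k)) (hP.w₁_situation x y k a)
  have hg₂ : ∀ ⦃s⦄ (k : G.Hist s) b, γ₂ k b = ((G.onSituations₁ x k).mean fun a _ =>
      G.stageMean k a b fun _ k => hP.value₂ x y (G.situation k))
        - hP.value₂ x y (G.situation k) := by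
    intro s k a
    exact congrArg (· - hP.value₂ x y (G.situation k)) (hP.w₂_situation x y k a)
  have hv₁_abs : ∀ ⦃s⦄ (k : G.Hist s), G.IsAbsorbing s →
      hP.value₁ x y (G.situation k) = G.r₁ s := fun s k hs =>
    hK.chainValue_of_isAbsorbing G.r₁ (a := G.situation k) hs
  have hv₂_abs : ∀ ⦃s⦄ (k : G.Hist s), G.IsAbsorbing s →
      hP.value₂ x y (G.situation k) = G.r₂ s := fun s k hs =>
    hK.chainValue_of_isAbsorbing G.r₂ (a := G.situation k) hs
  have hlo₁ : ∀ s, -1 / 2 ≤ G.payoff G.r₁ s := by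
    intro s
    unfold payoff
    split_ifs with hs
    · exact (hr₁ s hs).1
    · norm_num
  have hlo₂ : ∀ s, 0 ≤ G.payoff G.r₂ s := by
    intro s
    unfold payoff
    split_ifs with hs
    · exact hω₀.le.trans (hr₂ s hs).1
    · exact le_rfl
  -- With the deadline `N + 1` the stages `0, …, N + 1` can be tested, `N + 2` in all; no absorption
  -- before stage `N + 1` means being transient at time `N`.
  refine ⟨fun _ => N + 1, τ₁, τ₂, fun s => ?_, fun s σ₂ => ?_, fun s σ₁ => ?_, fun s =>
    ⟨fun σ₁ => ?_, fun σ₂ => ?_⟩⟩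
  · refine (chainLaw_not_absorbed_le _ AnyHist.state _ N).trans_lt ?_
    rw [hP.transient_playStep_eq x y]
    rw [ENNReal.ofReal_lt_ofReal_iff (by positivity)]
    refine (hN N le_rfl _).trans ?_
    linarith
  · exact (hτ₁ s σ₂).trans (by linarith)
  · exact (hτ₂ s σ₁).trans (by linarith)
  · have h₁ := histValue_deviation₁_le (β₁ := G.onSituations₁ x) (β₂ := G.onSituations₂ y)
      (g₁ := γ₁) (g₂ := γ₂) (deadline := fun _ => N + 1)
      (v₁ := fun _ k => hP.value₁ x y (G.situation k)) hτ₂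
      (fun s k => hj₁ (G.situation k))
      hg₁ σ₁
      (N + 2) (.start s) rfl (by simp [Hist.stage]) hε.le
    have h₂ := le_histValue_testAndPunish (β₁ := G.onSituations₁ x) (β₂ := G.onSituations₂ y)
      (g₁ := γ₁) (g₂ := γ₂) (deadline := fun _ => N + 1) (τ₁ := τ₁) (τ₂ := τ₂) hε
      (v := fun _ k => hP.value₁ x y (G.situation k)) (Φ := fun m _ k => Ψ m (G.situation k))
      hlo₁ (fun s k => (h.chainValue_le (fun s hs => (hr₁ s hs).2) _).trans (by norm_num))
      hv₁_abs (fun s k => hharm₁ _) (fun s k => hz₁ _) (fun s k => hz₂ _) (fun m s k => hΨ0 m _)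
      (fun s k => le_of_eq (by simp [hΨ, expectedSum, hu, situation])) hΨs (N + 2) (.start s) rfl
      (by simp [Hist.stage])
    simp only [score₁, score₂] at h₁ h₂
    rw [V₁_eq, V₁_eq]
    -- The bounds are `v + 2ε + ωε/2` for deviating and `v - (2ε - ωε + ωε/20)` for complying; they
    -- differ by less than `4ε`.
    have h₃ := hΨN (G.situation (.start s))
    norm_num at h₂
    linarith
  · have h₁ := histValue_deviation₂_le (β₁ := G.onSituations₁ x) (β₂ := G.onSituations₂ y)
      (g₁ := γ₁) (g₂ := γ₂) (deadline := fun _ => N + 1)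
      (v₂ := fun _ k => hP.value₂ x y (G.situation k)) hτ₁
      (fun s k => hj₂ (G.situation k))
      hg₂ σ₂
      (N + 2) (.start s) rfl (by simp [Hist.stage]) hε.le
    have h₂ := le_histValue_testAndPunish (β₁ := G.onSituations₁ x) (β₂ := G.onSituations₂ y)
      (g₁ := γ₁) (g₂ := γ₂) (deadline := fun _ => N + 1) (τ₁ := τ₁) (τ₂ := τ₂) hε
      (v := fun _ k => hP.value₂ x y (G.situation k)) (Φ := fun m _ k => Ψ m (G.situation k))
      hlo₂ (fun s k => (h.chainValue_le (fun s hs => (hr₂ s hs).2) _).trans (by norm_num))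
      hv₂_abs (fun s k => hharm₂ _) (fun s k => hz₁ _) (fun s k => hz₂ _) (fun m s k => hΨ0 m _)
      (fun s k => le_of_eq (by simp [hΨ, expectedSum, hu, situation])) hΨs (N + 2) (.start s) rfl
      (by simp [Hist.stage])
    simp only [score₁, score₂] at h₁ h₂
    rw [V₂_eq, V₂_eq]
    have h₃ := hΨN (G.situation (.start s))
    norm_num at h₂
    linarith

end Situations

end RecursiveGame

namespace RecursiveGame

universe u v w

variable {S : Type u} {A : S → Type v} {B : S → Type w} {G : RecursiveGame A B}

/-! ### States as the coarsest situations -/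

section StatesAsSituations

variable (G) in
theorem normal_top : G.Normal fun _ => ⊤ := fun _ _ _ _ _ _ _ _ => trivial

theorem situation_top_eq (c : G.Situation fun _ => ⊤) : c = G.situation (.start c.state) := by
  obtain ⟨s, q⟩ := c
  induction q using Quotient.inductionOn with
  | h k => exact congrArg (Situation.mk s) (Quotient.sound trivial)

/-- If histories with the same present state are not distinguished, situations are states. -/
def situationTopEquiv : G.Situation (fun _ => ⊤) ≃ S where
  toFun c := c.state
  invFun s := G.situation (.start s)
  left_inv c := (situation_top_eq c).symm
  right_inv _ := rfl

variable [Fintype S] [∀ s, Fintype (A s)] [∀ s, Fintype (B s)]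
  (x : ∀ s, PMF (A s)) (y : ∀ s, PMF (B s))

theorem value₁_top (c : G.Situation fun _ => ⊤) :
    G.normal_top.value₁ (fun c => x c.state) (fun c => y c.state) c = G.value₁ x y c.state := by
  conv_lhs => rw [situation_top_eq c]
  exact (G.normal_top.histValue_eq_chainValue (fun c => x c.state) (fun c => y c.state) G.r₁
    (.start c.state)).symm

theorem value₂_top (c : G.Situation fun _ => ⊤) :
    G.normal_top.value₂ (fun c => x c.state) (fun c => y c.state) c = G.value₂ x y c.state := by
  conv_lhs => rw [situation_top_eq c]
  exact (G.normal_top.histValue_eq_chainValue (fun c => x c.state) (fun c => y c.state) G.r₂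
    (.start c.state)).symm

theorem w₁_top (c : G.Situation fun _ => ⊤) (a : A c.state) :
    G.normal_top.w₁ (fun c => x c.state) (fun c => y c.state) c a = G.w₁ x y c.state a := by
  rw [Normal.w₁_eq_mean]
  simp only [value₁_top]
  unfold w₁ next
  simp only [← PMF.mean_eq_sum]
  rfl

theorem w₂_top (c : G.Situation fun _ => ⊤) (b : B c.state) :
    G.normal_top.w₂ (fun c => x c.state) (fun c => y c.state) c b = G.w₂ x y c.state b := by
  rw [Normal.w₂_eq_mean]
  simp only [value₂_top]
  unfold w₂ next
  simp only [← PMF.mean_eq_sum]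
  rfl

-- Absorption passes from the play to the chain on situations through the decay of the
-- finite-horizon probabilities, with no comparison of path measures.
variable {x y} in
theorem AbsorbingPair.absorbingPair_top (h : G.AbsorbingPair x y) :
    G.normal_top.AbsorbingPair (fun c => x c.state) (fun c => y c.state) := by
  intro c
  rw [situation_top_eq c]
  have ht := (G.respects_playStep (G.stationary₁ x) (G.stationary₂ y)).tendsto_transient
    (h c.state)
  have he : ∀ n, _ = _ := fun n => G.normal_top.transient_playStep_eq (fun c => x c.state)
    (fun c => y c.state) n (.start c.state)
  exact ae_absorbed_of_tendsto (Filter.Tendsto.congr he ht)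

end StatesAsSituations

end RecursiveGame

/-! ### The two statements combined -/

theorem corollary4p3 {S : Type*} [Fintype S] {A B : S → Type*}
    [∀ s, Fintype (A s)] [∀ s, Nonempty (A s)] [∀ s, Fintype (B s)] [∀ s, Nonempty (B s)]
    (G : RecursiveGame A B) (ω : ℝ) (hω₀ : 0 < ω) (hω₁ : ω < 1)
    (hr₁ : ∀ s, G.IsAbsorbing s → G.r₁ s ∈ Set.Icc (-1 / 2 : ℝ) (1 / 2))
    (hr₂ : ∀ s, G.IsAbsorbing s → G.r₂ s ∈ Set.Icc ω 1) :
    -- stationary strategies on the states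
    (∀ (x : ∀ s, PMF (A s)) (y : ∀ s, PMF (B s)) (ε δ : ℝ),
      G.AbsorbingPair x y →
      0 < ε → ε < 1 / 2 → δ ≤ ε ^ 3 / (Fintype.card S : ℝ) →
      (∀ s, G.value₁ x y s > G.jump₁ s (y s) - ε) →
      (∀ s, G.value₂ x y s > G.jump₂ s (x s) - ε) →
      (∀ s, ∀ a ∈ (x s).support, |G.w₁ x y s a - G.value₁ x y s| ≤ δ) →
      (∀ s, ∀ b ∈ (y s).support, |G.w₂ x y s b - G.value₂ x y s| ≤ δ) →
      G.GeneratesEquilibrium (G.stationary₁ x) (G.stationary₂ y)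
        (fun s _ a => G.w₁ x y s a - G.value₁ x y s)
        (fun s _ b => G.w₂ x y s b - G.value₂ x y s) ε (4 * ε)) ∧
    -- stationary strategies on normal situations
    (∀ (P : ∀ s, Setoid (G.Hist s)) (_ : Finite (G.Situation P)) (hP : G.Normal P)
      (x : ∀ c : G.Situation P, PMF (A c.state)) (y : ∀ c : G.Situation P, PMF (B c.state)) (ε δ : ℝ),
      hP.AbsorbingPair x y →
      0 < ε → δ ≤ ε ^ 3 / (Nat.card (G.Situation P) : ℝ) →
      (∀ c, hP.value₁ x y c ≥ G.jump₁ c.state (y c) - ε) →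
      (∀ c, hP.value₂ x y c ≥ G.jump₂ c.state (x c) - ε) →
      (∀ c, ∀ a ∈ (x c).support, |hP.w₁ x y c a - hP.value₁ x y c| ≤ δ) →
      (∀ c, ∀ b ∈ (y c).support, |hP.w₂ x y c b - hP.value₂ x y c| ≤ δ) →
      G.GeneratesEquilibrium (G.onSituations₁ x) (G.onSituations₂ y)
        (fun _ h a => hP.w₁ x y (G.situation h) a - hP.value₁ x y (G.situation h))
        (fun _ h b => hP.w₂ x y (G.situation h) b - hP.value₂ x y (G.situation h))
        ε (4 * ε)) := by
  refine ⟨fun x y ε δ h hε _ hδ hj₁ hj₂ hw₁ hw₂ => ?_,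
    fun P _ hP x y ε δ h hε hδ hj₁ hj₂ hw₁ hw₂ =>
      h.generatesEquilibrium hω₀ hω₁ hr₁ hr₂ hε hδ hj₁ hj₂ hw₁ hw₂⟩
  have hfin : Finite (G.Situation fun _ => ⊤) :=
    Finite.of_equiv S RecursiveGame.situationTopEquiv.symm
  have hcard : Nat.card (G.Situation fun _ => ⊤) = Fintype.card S := by
    rw [Nat.card_congr RecursiveGame.situationTopEquiv, Nat.card_eq_fintype_card]
  have key := h.absorbingPair_top.generatesEquilibrium hω₀ hω₁ hr₁ hr₂ hε (hcard ▸ hδ)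
    (fun c => (hj₁ c.state).le.trans (RecursiveGame.value₁_top x y c).ge)
    (fun c => (hj₂ c.state).le.trans (RecursiveGame.value₂_top x y c).ge)
    (fun c a ha => by
      rw [RecursiveGame.w₁_top, RecursiveGame.value₁_top]; exact hw₁ c.state a ha)
    (fun c b hb => by
      rw [RecursiveGame.w₂_top, RecursiveGame.value₂_top]; exact hw₂ c.state b hb)
  have hg₁ : (fun s (_ : G.Hist s) a => G.w₁ x y s a - G.value₁ x y s) = fun _ k a =>
      G.normal_top.w₁ (fun c => x c.state) (fun c => y c.state) (G.situation k) a
        - G.normal_top.value₁ (fun c => x c.state) (fun c => y c.state) (G.situation k) := by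
    funext s k a
    rw [RecursiveGame.value₁_top]
    exact congrArg (· - G.value₁ x y s) (RecursiveGame.w₁_top x y (G.situation k) a).symm
  have hg₂ : (fun s (_ : G.Hist s) b => G.w₂ x y s b - G.value₂ x y s) = fun _ k b =>
      G.normal_top.w₂ (fun c => x c.state) (fun c => y c.state) (G.situation k) b
        - G.normal_top.value₂ (fun c => x c.state) (fun c => y c.state) (G.situation k) := by
    funext s k b
    rw [RecursiveGame.value₂_top]
    exact congrArg (· - G.value₂ x y s) (RecursiveGame.w₂_top x y (G.situation k) b).symm
  rw [hg₁, hg₂]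
  exact key
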